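/- For $1<p<\infty$, $0<\lambda<N$ and a measurable $f:\mathbb R^N\to\mathbb R$ let $$\|f\|_{M^\lambda_p}=\Big(\sup_{x\in\mathbb R^N}\sup_{r>0} r^{-\lambda}\int_{B(x,r)}|f(y)|^p\,dy\Big)^{1/p}\in[0,\infty]$$ be the global Morrey norm, let $|\cdot|$ be the Euclidean norm and $p'=p/(p-1)$. For $0<s<1$ and a Schwartz function $u$ let $$(-\Delta)^su(x)=\frac{A(N,s)}2\int_{\mathbb R^N}\frac{2u(x)-u(x+y)-u(x-y)}{|y|^{N+2s}}\,dy,\qquad A(N,s)=\frac{s\,4^s\,\Gamma(N/2+s)}{\pi^{N/2}\,\Gamma(1-s)}.$$ Say that $u$ vanishes at infinity in mean if $\frac1{|B(0,R)|}\int_{B(0,R)}|u|\,dx\to0$ as $R\to\infty$ (for example, if $u$ is continuous and $u(x)\to0$ as $|x|\to\infty$). **Theorem (integer and fractional Rellich inequalities on Morrey spaces).** (a) Let $1<p<\infty$, $\alpha,\beta\in\mathbb R$, $\alpha+\beta=2$, $\alpha<\frac N{p'}$, $\beta<\frac{N-\lambda}p$ and $0<\lambda<\min\{N,N-\beta p\}$.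 Then there is a constant $C>0$, independent of $u$, such that for all real $u\in C^2(\mathbb R^N)$ that vanish at infinity in mean $$\Big\|\frac u{|\cdot|^\beta}\Big\|_{M^\lambda_p}\le C\,\big\||\cdot|^\alpha\Delta u\big\|_{M^\lambda_p}.$$ (b) In particular ($\alpha=0$), if $p>1$, $N>2p$ and $0<\lambda<N-2p$, then there is a constant $C>0$ such that for all such $u$ $$\Big\|\frac u{|\cdot|^2}\Big\|_{M^\lambda_p}\le C\,\|\Delta u\|_{M^\lambda_p}.$$ (c) Let $p>1$, $\alpha,\beta\in\mathbb R$, $\alpha<\frac N{p'}$, $\beta<\frac{N-\lambda}p$, $\alpha+\beta=\gamma\in(1,2)$, $N>\gamma p$ and $0<\lambda<\min\{N,N-\gamma p\}$. Then there is a constant $C>0$ such that for all real Schwartz functions $u$ on $\mathbb R^N$ $$\big\||\cdot|^{-\beta}u\big\|_{M^\lambda_p}\le C\,\big\||\cdot|^{\alpha}(-\Delta)^{\gamma/2}u\big\|_{M^\lambda_p}.$$ (d) In particular ($\alpha=0$), if $\gamma\in(1,2)$, $p>1$, $N>\gamma p$ and $0<\lambda<N-\gamma p$, then there is a constant $C>0$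 such that for all real Schwartz functions $u$ on $\mathbb R^N$ $$\big\||\cdot|^{-\gamma}u\big\|_{M^\lambda_p}\le C\,\|(-\Delta)^{\gamma/2}u\|_{M^\lambda_p}.$$ -/

import Mathlib

open MeasureTheory Filter Topology
open scoped ENNReal NNReal SchwartzMap Laplacian

/-- The norm of the global Morrey space `M^lam_p(ℝ^N)`,
`‖f‖ = (sup_x sup_{r>0} r^{-lam} ∫_{B(x,r)} |f(y)|^p dy)^{1/p}`, with values in `[0,∞]`. It is finite
exactly when the (measurable) function `f` belongs to the space. -/
noncomputable def morreyNorm {N : ℕ} (p lam : ℝ) (f : EuclideanSpace ℝ (Fin N) → ℝ) : ℝ≥0∞ :=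
  (⨆ x : EuclideanSpace ℝ (Fin N), ⨆ r : ℝ, ⨆ _ : 0 < r,
    ENNReal.ofReal (r ^ (-lam)) * ∫⁻ y in Metric.ball x r, ‖f y‖ₑ ^ p) ^ (1 / p)

/-- The normalization constant `A(N,s) = s 4^s Γ(N/2+s) / (π^{N/2} Γ(1-s))` of the fractional
Laplacian, `0 < s < 1`; it gives `(-Δ)^s` the Fourier symbol `|ξ|^{2s}`. -/
noncomputable def fracLaplacianConst (N : ℕ) (s : ℝ) : ℝ :=
  s * 4 ^ s * Real.Gamma ((N : ℝ) / 2 + s) / (Real.pi ^ ((N : ℝ) / 2) * Real.Gamma (1 - s))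

/-- The fractional Laplacian `(-Δ)^s u`, `0 < s < 1`, as the integral of weighted second differences.
The integral converges absolutely if `u` is a Schwartz function. -/
noncomputable def fracLaplacian {N : ℕ} (s : ℝ) (u : EuclideanSpace ℝ (Fin N) → ℝ)
    (x : EuclideanSpace ℝ (Fin N)) : ℝ :=
  fracLaplacianConst N s / 2 *
    ∫ y : EuclideanSpace ℝ (Fin N),
      (2 * u x - u (x + y) - u (x - y)) / ‖y‖ ^ ((N : ℝ) + 2 * s)

/-- `u` vanishes at infinity in mean: the average of `|u|` over the ball `B(0,R)` tends to `0` as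
`R → ∞`. For a locally integrable `u` this holds if `u(x) → 0` as `|x| → ∞`, and it excludes the
nonzero harmonic functions. -/
def VanishesInMean {N : ℕ} (u : EuclideanSpace ℝ (Fin N) → ℝ) : Prop :=
  Tendsto (fun R : ℝ => ⨍ y in Metric.ball (0 : EuclideanSpace ℝ (Fin N)) R, |u y|) atTop (𝓝 0)

/-! Both inequalities reduce to a pointwise bound `|u| ≤ K I_γ|f|` by the Riesz potential of order
`γ = α + β`, with `f = Δu` and `γ = 2`, or `f = (-Δ)^{γ/2} u`. What remains is a Stein-Weiss
inequality on Morrey spaces: the operator with kernel `|x|^{-β} |x-y|^{γ-n} |y|^{-α}`, applied to `g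
= |·|^α |f|`, is bounded (`exists_lintegral_steinWeiss_rpow_le`).

The kernel is split at `|x-y| = |x|/2`. Away from the diagonal, Hölder on centred balls and dyadic
summation bound the operator pointwise by a multiple of `|x|^{(λ-n)/p}`; the `p`-th power
`|x|^{λ-n}` has Morrey growth `r^λ`. The bounds on `α` and `β` give convergence at the origin and at
infinity. Near the diagonal, `y = x - |x| z` turns the operator into an integral over `|z| ≤ 1/2` of
`g(x - |x| z)` against the finite measure `|z|^{γ-n} dz`. Each map `x ↦ x - |x| z` distorts
distances by at most a factor 2, so composition with it preserves Morrey bounds up to a constant,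
and no maximal function is needed.

For the Laplacian, let `w = (1-|y|²)₊`. Since `∇(w²) = -4 w y`, the derivative in `t` of `∫ w(y)
u(x+ty) dy` is `(t/4) ∫ w(y)² Δu(x+ty) dy`. Integration over `t > 0`, where vanishing in mean
removes the term at infinity, gives the Newtonian bound. For the fractional Laplacian, the second
differences act as the Fourier multiplier `κ|ξ|^{2s}` with `κ > 0`, whose exact value is irrelevant;
writing `|ξ|^{-2s}` as a superposition of Gaussians inverts it with kernel bounded by a multiple of
`|z|^{2s-n}`. -/

/-! ### Power weights and dyadic shells -/

section Radial

variable {E : Type*} [NormedAddCommGroup E] [MeasurableSpace E] [BorelSpace E]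

theorem rpow_neg_le_of_mem_shell {R t σ : ℝ} (hR : 0 < R) (h1 : R ≤ t) (h2 : t ≤ 2 * R) :
    t ^ (-σ) ≤ 2 ^ |σ| * R ^ (-σ) := by
  have ht : 0 < t := hR.trans_le h1
  rcases le_total 0 σ with h | h
  · rw [abs_of_nonneg h]
    have : t ^ (-σ) ≤ R ^ (-σ) := Real.rpow_le_rpow_of_nonpos hR h1 (by linarith)
    have h3 : (1 : ℝ) ≤ 2 ^ σ := Real.one_le_rpow (by norm_num) h
    have h4 : 0 < R ^ (-σ) := Real.rpow_pos_of_pos hR _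
    nlinarith
  · rw [abs_of_nonpos h, ← Real.mul_rpow (by norm_num) hR.le]
    exact Real.rpow_le_rpow ht.le h2 (by linarith)

theorem lintegral_shell_norm_rpow_mul_le (μ : Measure E) {G : E → ℝ≥0∞} {A : ℝ≥0∞} {κ : ℝ} (σ : ℝ)
    (hG : ∀ r : ℝ, 0 < r → ∫⁻ y in Metric.ball 0 r, G y ∂μ ≤ A * ENNReal.ofReal (r ^ κ))
    {R : ℝ} (hR : 0 < R) :
    ∫⁻ y in {y : E | R ≤ ‖y‖ ∧ ‖y‖ ≤ 2 * R}, ENNReal.ofReal (‖y‖ ^ (-σ)) * G y ∂μ ≤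
      ENNReal.ofReal (2 ^ |σ| * 4 ^ κ) * A * ENNReal.ofReal (R ^ (κ - σ)) := by
  have hm : MeasurableSet {y : E | R ≤ ‖y‖ ∧ ‖y‖ ≤ 2 * R} :=
    (measurableSet_le measurable_const measurable_norm).inter
      (measurableSet_le measurable_norm measurable_const)
  calc ∫⁻ y in {y : E | R ≤ ‖y‖ ∧ ‖y‖ ≤ 2 * R}, ENNReal.ofReal (‖y‖ ^ (-σ)) * G y ∂μ
      ≤ ∫⁻ y in {y : E | R ≤ ‖y‖ ∧ ‖y‖ ≤ 2 * R}, ENNReal.ofReal (2 ^ |σ| * R ^ (-σ)) * G y ∂μ := by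
        refine setLIntegral_mono' hm fun y hy => ?_
        gcongr
        exact rpow_neg_le_of_mem_shell hR hy.1 hy.2
    _ = ENNReal.ofReal (2 ^ |σ| * R ^ (-σ)) *
          ∫⁻ y in {y : E | R ≤ ‖y‖ ∧ ‖y‖ ≤ 2 * R}, G y ∂μ := lintegral_const_mul' _ _ (by simp)
    -- The shell is closed and the growth hypothesis concerns open balls, so a radius above `2R` is
    -- taken.
    _ ≤ ENNReal.ofReal (2 ^ |σ| * R ^ (-σ)) * ∫⁻ y in Metric.ball 0 (4 * R), G y ∂μ := by
        gcongr
        intro y hy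
        rw [mem_ball_zero_iff]
        linarith [hy.2]
    _ ≤ ENNReal.ofReal (2 ^ |σ| * R ^ (-σ)) * (A * ENNReal.ofReal ((4 * R) ^ κ)) := by
        gcongr
        exact hG _ (by positivity)
    _ = _ := by
        rw [Real.mul_rpow (by norm_num) hR.le, sub_eq_add_neg, Real.rpow_add hR,
          ENNReal.ofReal_mul (by positivity), ENNReal.ofReal_mul (by positivity),
          ENNReal.ofReal_mul (by positivity), ENNReal.ofReal_mul (by positivity)]
        ring

/-- The shell of radius `ρ q^k` contributes at most a constant times `ρ^(κ-σ) (q^(κ-σ))^k`, a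
convergent geometric series. Taking `q = 1/2` sums towards the origin and `q = 2` towards infinity.
-/
theorem exists_lintegral_iUnion_shell_le {κ σ q : ℝ} (hq : 0 < q) (hqθ : q ^ (κ - σ) < 1) :
    ∃ C : ℝ≥0, ∀ (μ : Measure E) (G : E → ℝ≥0∞) (A : ℝ≥0∞),
      (∀ r : ℝ, 0 < r → ∫⁻ y in Metric.ball 0 r, G y ∂μ ≤ A * ENNReal.ofReal (r ^ κ)) →
      ∀ ρ : ℝ, 0 < ρ →
        ∫⁻ y in ⋃ k : ℕ, {y : E | ρ * q ^ k ≤ ‖y‖ ∧ ‖y‖ ≤ 2 * (ρ * q ^ k)},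
          ENNReal.ofReal (‖y‖ ^ (-σ)) * G y ∂μ ≤ C * A * ENNReal.ofReal (ρ ^ (κ - σ)) := by
  have hfin : (1 - ENNReal.ofReal (q ^ (κ - σ)))⁻¹ ≠ ⊤ := by
    simp only [ne_eq, ENNReal.inv_eq_top, tsub_eq_zero_iff_le, not_le]
    simpa using hqθ
  refine ⟨(2 ^ |σ| * 4 ^ κ : ℝ).toNNReal * (1 - ENNReal.ofReal (q ^ (κ - σ)))⁻¹.toNNReal,
    fun μ G A hG ρ hρ => ?_⟩
  refine (lintegral_iUnion_le _ _).trans ?_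
  calc ∑' k : ℕ, ∫⁻ y in {y : E | ρ * q ^ k ≤ ‖y‖ ∧ ‖y‖ ≤ 2 * (ρ * q ^ k)},
          ENNReal.ofReal (‖y‖ ^ (-σ)) * G y ∂μ
      ≤ ∑' k : ℕ, ENNReal.ofReal (2 ^ |σ| * 4 ^ κ) * A * ENNReal.ofReal (ρ ^ (κ - σ)) *
          ENNReal.ofReal (q ^ (κ - σ)) ^ k := by
        refine ENNReal.tsum_le_tsum fun k => ?_
        refine (lintegral_shell_norm_rpow_mul_le μ σ hG (by positivity)).trans_eq ?_
        rw [Real.mul_rpow hρ.le (by positivity), ENNReal.ofReal_mul (p := ρ ^ (κ - σ)) (by positivity),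
          ← ENNReal.ofReal_pow (by positivity), ← Real.rpow_natCast, ← Real.rpow_natCast,
          ← Real.rpow_mul hq.le, ← Real.rpow_mul hq.le, mul_comm (k : ℝ)]
        ring
    _ = _ := by
        rw [ENNReal.tsum_mul_left, ENNReal.tsum_geometric, ENNReal.coe_mul,
          ENNReal.coe_toNNReal hfin]
        simp only [ENNReal.ofReal]
        ring

theorem exists_lintegral_ball_norm_rpow_mul_le {κ σ : ℝ} (h : σ < κ) :
    ∃ C : ℝ≥0, ∀ (μ : Measure E) [NullSingletonClass μ] (G : E → ℝ≥0∞) (A : ℝ≥0∞),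
      (∀ r : ℝ, 0 < r → ∫⁻ y in Metric.ball 0 r, G y ∂μ ≤ A * ENNReal.ofReal (r ^ κ)) →
      ∀ ρ : ℝ, 0 < ρ → ∫⁻ y in Metric.ball 0 ρ, ENNReal.ofReal (‖y‖ ^ (-σ)) * G y ∂μ ≤
        C * A * ENNReal.ofReal (ρ ^ (κ - σ)) := by
  obtain ⟨C, hC⟩ := exists_lintegral_iUnion_shell_le (E := E) (κ := κ) (σ := σ) (q := 1 / 2)
    (by norm_num) (Real.rpow_lt_one (by norm_num) (by norm_num) (by linarith))
  refine ⟨C * (((1 / 2 : ℝ) ^ (κ - σ)).toNNReal), fun μ _ G A hG ρ hρ => ?_⟩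
  -- Starting at `ρ/2` makes the `k`-th shell `ρ 2^(-k-1) ≤ ‖y‖ ≤ ρ 2^(-k)`, so that the shells
  -- cover the punctured ball.
  have h1 := hC μ G A hG (ρ * (1 / 2)) (by positivity)
  rw [Real.mul_rpow hρ.le (by norm_num), ENNReal.ofReal_mul (by positivity)] at h1
  have h2 : ∫⁻ y in Metric.ball 0 ρ, ENNReal.ofReal (‖y‖ ^ (-σ)) * G y ∂μ =
      ∫⁻ y in Metric.ball 0 ρ \ {0}, ENNReal.ofReal (‖y‖ ^ (-σ)) * G y ∂μ :=
    setLIntegral_congr (sdiff_null_ae_eq_self (measure_singleton 0)).symm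
  rw [h2]
  refine (lintegral_mono_set ?_).trans (h1.trans_eq ?_)
  · rintro y ⟨hy, hy0⟩
    rw [mem_ball_zero_iff] at hy
    have hy0 : 0 < ‖y‖ := norm_pos_iff.2 hy0
    obtain ⟨n, hn1, hn2⟩ := exists_nat_pow_near_of_lt_one (x := ‖y‖ / ρ) (y := (1 / 2 : ℝ))
      (by positivity) ((div_le_one hρ).2 hy.le) (by norm_num) (by norm_num)
    rw [lt_div_iff₀ hρ, pow_succ] at hn1
    rw [div_le_iff₀ hρ] at hn2
    refine Set.mem_iUnion.2 ⟨n, ?_, ?_⟩ <;> linarith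
  · rw [ENNReal.coe_mul]
    simp only [ENNReal.ofReal]
    ring

theorem exists_lintegral_compl_ball_norm_rpow_mul_le {κ σ : ℝ} (h : κ < σ) :
    ∃ C : ℝ≥0, ∀ (μ : Measure E) (G : E → ℝ≥0∞) (A : ℝ≥0∞),
      (∀ r : ℝ, 0 < r → ∫⁻ y in Metric.ball 0 r, G y ∂μ ≤ A * ENNReal.ofReal (r ^ κ)) →
      ∀ ρ : ℝ, 0 < ρ → ∫⁻ y in (Metric.ball 0 ρ)ᶜ, ENNReal.ofReal (‖y‖ ^ (-σ)) * G y ∂μ ≤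
        C * A * ENNReal.ofReal (ρ ^ (κ - σ)) := by
  obtain ⟨C, hC⟩ := exists_lintegral_iUnion_shell_le (E := E) (κ := κ) (σ := σ) (q := 2)
    (by norm_num) (Real.rpow_lt_one_of_one_lt_of_neg (by norm_num) (by linarith))
  refine ⟨C, fun μ G A hG ρ hρ => (lintegral_mono_set ?_).trans (hC μ G A hG ρ hρ)⟩
  intro y hy
  simp only [Set.mem_compl_iff, mem_ball_zero_iff, not_lt] at hy
  obtain ⟨n, hn1, hn2⟩ := exists_nat_pow_near (x := ‖y‖ / ρ) (y := (2 : ℝ))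
    ((one_le_div hρ).2 hy) (by norm_num)
  rw [le_div_iff₀ hρ] at hn1
  rw [div_lt_iff₀ hρ, pow_succ] at hn2
  refine Set.mem_iUnion.2 ⟨n, ?_, ?_⟩ <;> linarith

end Radial

/-! ### Haar measure: powers of the norm and antilipschitz maps -/

section Haar

variable {E : Type*} [NormedAddCommGroup E] [NormedSpace ℝ E] [FiniteDimensional ℝ E]
  [MeasurableSpace E] [BorelSpace E] (μ : Measure E) [μ.IsAddHaarMeasure]

theorem measure_ball_zero_le_mul_rpow (r : ℝ) (hr : 0 < r) :
    ∫⁻ _ in Metric.ball (0 : E) r, 1 ∂μ ≤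
      μ (Metric.ball 0 1) * ENNReal.ofReal (r ^ (Module.finrank ℝ E : ℝ)) := by
  rw [setLIntegral_one, Measure.addHaar_ball_of_pos μ 0 hr, mul_comm, Real.rpow_natCast]

theorem exists_lintegral_ball_zero_norm_rpow_le [Nontrivial E] {σ : ℝ}
    (h : σ < Module.finrank ℝ E) :
    ∃ C : ℝ≥0, ∀ ρ : ℝ, 0 < ρ → ∫⁻ y in Metric.ball (0 : E) ρ, ENNReal.ofReal (‖y‖ ^ (-σ)) ∂μ ≤
      C * ENNReal.ofReal (ρ ^ (Module.finrank ℝ E - σ)) := by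
  obtain ⟨C, hC⟩ := exists_lintegral_ball_norm_rpow_mul_le (E := E) h
  refine ⟨C * (μ (Metric.ball 0 1)).toNNReal, fun ρ hρ => ?_⟩
  have := hC μ (fun _ => 1) _ (measure_ball_zero_le_mul_rpow μ) ρ hρ
  simpa [ENNReal.coe_toNNReal measure_ball_lt_top.ne] using this

theorem exists_lintegral_compl_ball_norm_rpow_le {σ : ℝ} (h : Module.finrank ℝ E < σ) :
    ∃ C : ℝ≥0, ∀ ρ : ℝ, 0 < ρ →
      ∫⁻ y in (Metric.ball (0 : E) ρ)ᶜ, ENNReal.ofReal (‖y‖ ^ (-σ)) ∂μ ≤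
        C * ENNReal.ofReal (ρ ^ (Module.finrank ℝ E - σ)) := by
  obtain ⟨C, hC⟩ := exists_lintegral_compl_ball_norm_rpow_mul_le (E := E) h
  refine ⟨C * (μ (Metric.ball 0 1)).toNNReal, fun ρ hρ => ?_⟩
  have := hC μ (fun _ => 1) _ (measure_ball_zero_le_mul_rpow μ) ρ hρ
  simpa [ENNReal.coe_toNNReal measure_ball_lt_top.ne] using this

/-- The power `‖x‖ ^ (lam - n)` integrates over every ball of radius `r` to at most `C r ^ lam`. -/
theorem exists_lintegral_ball_norm_rpow_le [Nontrivial E] {lam : ℝ} (h0 : 0 < lam)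
    (h1 : lam ≤ Module.finrank ℝ E) :
    ∃ C : ℝ≥0, ∀ (x : E) (r : ℝ), 0 < r →
      ∫⁻ y in Metric.ball x r, ENNReal.ofReal (‖y‖ ^ (lam - Module.finrank ℝ E)) ∂μ ≤
        C * ENNReal.ofReal (r ^ lam) := by
  obtain ⟨C, hC⟩ := exists_lintegral_ball_zero_norm_rpow_le μ
    (σ := Module.finrank ℝ E - lam) (by linarith)
  refine ⟨C + (μ (Metric.ball 0 1)).toNNReal, fun x r hr => ?_⟩
  -- Uniformity in the centre `x`: outside `B(0,r)` the nonincreasing power is at most `r^(lam-n)`,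
  -- and inside it the centred estimate applies.
  have key : ∀ y ∈ Metric.ball x r, ENNReal.ofReal (‖y‖ ^ (lam - Module.finrank ℝ E)) ≤
      (Metric.ball (0 : E) r).indicator
        (fun y => ENNReal.ofReal (‖y‖ ^ (lam - Module.finrank ℝ E))) y +
      ENNReal.ofReal (r ^ (lam - Module.finrank ℝ E)) := by
    intro y _
    by_cases hy : y ∈ Metric.ball (0 : E) r
    · rw [Set.indicator_of_mem hy]; exact le_self_add
    · rw [Set.indicator_of_notMem hy, zero_add]
      rw [mem_ball_zero_iff, not_lt] at hy
      exact ENNReal.ofReal_le_ofReal (Real.rpow_le_rpow_of_nonpos hr hy (sub_nonpos.2 h1))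
  refine (setLIntegral_mono' measurableSet_ball key).trans ?_
  rw [lintegral_add_right _ measurable_const, ENNReal.coe_add, add_mul]
  gcongr
  · refine (setLIntegral_le_lintegral _ _).trans ?_
    rw [lintegral_indicator measurableSet_ball]
    simpa using hC r hr
  · rw [setLIntegral_const, Measure.addHaar_ball_of_pos μ x hr,
      ENNReal.coe_toNNReal measure_ball_lt_top.ne, ← Real.rpow_natCast, ← mul_assoc,
      ← ENNReal.ofReal_mul (by positivity), ← Real.rpow_add hr, mul_comm]
    simp

/-- Haar measure is a multiple of `n`-dimensional Hausdorff measure, and preimages under a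
`K`-antilipschitz map enlarge the latter by at most `K^n`. This replaces a change of variables and
needs no differentiability of `Φ`. -/
theorem AntilipschitzWith.exists_lintegral_comp_le (K : ℝ≥0) :
    ∃ C : ℝ≥0, ∀ Φ : E → E, Measurable Φ → AntilipschitzWith K Φ →
      ∀ F : E → ℝ≥0∞, Measurable F → ∫⁻ x, F (Φ x) ∂μ ≤ C * ∫⁻ x, F x ∂μ := by
  set n := Module.finrank ℝ E
  have hμ := Measure.isAddLeftInvariant_eq_smul μ (Measure.hausdorffMeasure (X := E) (n : ℝ))
  set c := μ.addHaarScalarFactor (Measure.hausdorffMeasure (X := E) (n : ℝ))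
  refine ⟨K ^ (n : ℝ), fun Φ hΦ hK F hF => ?_⟩
  rw [← lintegral_map hF hΦ, ← smul_eq_mul, ← lintegral_smul_measure]
  refine lintegral_mono' (Measure.le_iff.2 fun s hs => ?_) le_rfl
  rw [Measure.map_apply hΦ hs, hμ]
  simp only [Measure.smul_apply, smul_eq_mul, ENNReal.smul_def]
  have := hK.hausdorffMeasure_preimage_le (d := (n : ℝ)) (by positivity) s
  calc (c : ℝ≥0∞) * _ ≤ c * (K ^ (n : ℝ) * Measure.hausdorffMeasure (n : ℝ) s) := by gcongr
    _ = _ := by rw [ENNReal.coe_rpow_of_nonneg _ (by positivity)]; ring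

end Haar

/-! ### Hölder estimates and the maps `x ↦ x - ‖x‖ • z` -/

theorem rpow_neg_le_of_half_le {R t σ : ℝ} (hR : 0 < R) (h1 : R / 2 ≤ t) (h2 : t ≤ 2 * R) :
    t ^ (-σ) ≤ 2 ^ |σ| * R ^ (-σ) := by
  have ht : 0 < t := (half_pos hR).trans_le h1
  rcases le_total 0 σ with h | h
  · rw [abs_of_nonneg h]
    refine (Real.rpow_le_rpow_of_nonpos (half_pos hR) h1 (by linarith)).trans_eq ?_
    rw [Real.div_rpow hR.le (by norm_num), Real.rpow_neg (by norm_num : (0:ℝ) ≤ 2)]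
    field_simp
  · rw [abs_of_nonpos h, ← Real.mul_rpow (by norm_num) hR.le]
    exact Real.rpow_le_rpow ht.le h2 (by linarith)

theorem lintegral_le_lintegral_rpow_mul_measure_univ {X : Type*} [MeasurableSpace X]
    (ν : Measure X) {p : ℝ} (hp : 1 < p) {g : X → ℝ≥0∞} (hg : AEMeasurable g ν) :
    ∫⁻ x, g x ∂ν ≤ (∫⁻ x, g x ^ p ∂ν) ^ (1 / p) * ν Set.univ ^ (1 - 1 / p) := by
  have hpq : p.HolderConjugate p.conjExponent := Real.HolderConjugate.conjExponent hp
  have h := ENNReal.lintegral_mul_le_Lp_mul_Lq ν hpq hg (aemeasurable_const (b := (1 : ℝ≥0∞)))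
  simp only [Pi.mul_apply, mul_one, ENNReal.one_rpow, lintegral_const, one_mul] at h
  convert h using 3
  have := hpq.inv_add_inv_eq_one
  simp only [one_div]
  linarith

theorem lintegral_rpow_le_mul_lintegral {X : Type*} [MeasurableSpace X]
    (ν : Measure X) {p : ℝ} (hp : 1 < p) {g : X → ℝ≥0∞} (hg : AEMeasurable g ν) :
    (∫⁻ x, g x ∂ν) ^ p ≤ ν Set.univ ^ (p - 1) * ∫⁻ x, g x ^ p ∂ν := by
  have hp0 : 0 < p := by linarith
  refine (ENNReal.rpow_le_rpow (lintegral_le_lintegral_rpow_mul_measure_univ ν hp hg)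
    hp0.le).trans_eq ?_
  rw [ENNReal.mul_rpow_of_nonneg _ _ hp0.le, ← ENNReal.rpow_mul, ← ENNReal.rpow_mul,
    one_div_mul_cancel hp0.ne', ENNReal.rpow_one, mul_comm]
  congr 2
  field_simp

/-- The perturbation `x ↦ ‖x‖ • z` is `1/2`-Lipschitz, so subtracting it from the identity shrinks
distances by at most a factor 2. -/
theorem antilipschitzWith_sub_norm_smul {E : Type*} [NormedAddCommGroup E] [NormedSpace ℝ E] {z : E} (hz : ‖z‖ ≤ 1 / 2) :
    AntilipschitzWith 2 fun x : E => x - ‖x‖ • z := by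
  refine AntilipschitzWith.of_le_mul_dist fun x y => ?_
  rw [dist_eq_norm, dist_eq_norm]
  have h1 : ‖(‖x‖ - ‖y‖) • z‖ ≤ ‖x - y‖ * (1 / 2) := by
    rw [norm_smul, Real.norm_eq_abs]
    exact mul_le_mul (abs_norm_sub_norm_le x y) hz (norm_nonneg _) (norm_nonneg _)
  have h2 : ‖x - y‖ ≤ ‖x - ‖x‖ • z - (y - ‖y‖ • z)‖ + ‖(‖x‖ - ‖y‖) • z‖ := by
    refine le_trans (le_of_eq ?_) (norm_add_le _ _)
    congr 1
    rw [sub_smul]; abel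
  norm_num
  linarith

theorem dist_sub_norm_smul_le {E : Type*} [NormedAddCommGroup E] [NormedSpace ℝ E]
    {z : E} (hz : ‖z‖ ≤ 1 / 2) (x y : E) :
    dist (x - ‖x‖ • z) (y - ‖y‖ • z) ≤ 2 * dist x y := by
  rw [dist_eq_norm, dist_eq_norm]
  have h1 : ‖(‖x‖ - ‖y‖) • z‖ ≤ ‖x - y‖ * (1 / 2) := by
    rw [norm_smul, Real.norm_eq_abs]
    exact mul_le_mul (abs_norm_sub_norm_le x y) hz (norm_nonneg _) (norm_nonneg _)
  have h2 : ‖x - ‖x‖ • z - (y - ‖y‖ • z)‖ ≤ ‖x - y‖ + ‖(‖x‖ - ‖y‖) • z‖ := by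
    refine le_trans (le_of_eq ?_) (norm_sub_le _ _)
    congr 1
    rw [sub_smul]; abel
  linarith [norm_nonneg (x - y)]

section

variable {E : Type*} [NormedAddCommGroup E] [NormedSpace ℝ E] [MeasurableSpace E] [BorelSpace E]
  (μ : Measure E)

/-- Weighted measure `‖z‖ ^ (γ - n) dz` on the ball of radius `1 / 2`. -/
noncomputable def rieszBallMeasure (γ : ℝ) : Measure E :=
  (μ.restrict (Metric.closedBall 0 (1 / 2))).withDensity
    fun z => ENNReal.ofReal (‖z‖ ^ (γ - Module.finrank ℝ E))

theorem lintegral_rieszBallMeasure (γ : ℝ) {F : E → ℝ≥0∞} (hF : Measurable F) :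
    ∫⁻ z, F z ∂rieszBallMeasure μ γ = ∫⁻ z in Metric.closedBall 0 (1 / 2),
      ENNReal.ofReal (‖z‖ ^ (γ - Module.finrank ℝ E)) * F z ∂μ := by
  rw [rieszBallMeasure, lintegral_withDensity_eq_lintegral_mul _ (by fun_prop) hF]
  rfl

end

/-! ### Stein-Weiss inequality under Morrey growth -/

section SteinWeiss

variable {E : Type*} [NormedAddCommGroup E] [NormedSpace ℝ E] [FiniteDimensional ℝ E]
  [MeasurableSpace E] [BorelSpace E] (μ : Measure E) [μ.IsAddHaarMeasure]

theorem lintegral_comp_smul_haar {R : ℝ} (hR : 0 < R) (F : E → ℝ≥0∞) :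
    ∫⁻ z, F z ∂μ = ENNReal.ofReal (R ^ Module.finrank ℝ E) * ∫⁻ z, F (R • z) ∂μ := by
  have h := lintegral_map_equiv (μ := μ) F (Homeomorph.smulOfNeZero R hR.ne' : E ≃ₜ E).toMeasurableEquiv
  have h2 : Measure.map ((Homeomorph.smulOfNeZero R hR.ne' : E ≃ₜ E).toMeasurableEquiv) μ =
      ENNReal.ofReal |(R ^ Module.finrank ℝ E)⁻¹| • μ := Measure.map_addHaar_smul μ hR.ne'
  rw [h2, lintegral_smul_measure, smul_eq_mul] at h
  have h3 : ∫⁻ z, F (R • z) ∂μ =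
    ∫⁻ z, F ((Homeomorph.smulOfNeZero R hR.ne' : E ≃ₜ E).toMeasurableEquiv z) ∂μ := rfl
  rw [h3, ← h, ← mul_assoc, ← ENNReal.ofReal_mul (by positivity), abs_of_nonneg (by positivity),
    mul_inv_cancel₀ (by positivity), ENNReal.ofReal_one, one_mul]

/-- Hölder against the constant 1: the Morrey bound contributes `r^(lam/p)` and the volume
`r^(n(1-1/p))`. The result is the growth hypothesis of the dyadic estimates. -/
theorem lintegral_ball_le_of_lintegral_rpow_le {p lam : ℝ} (hp : 1 < p) {g : E → ℝ≥0∞}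
    (hg : Measurable g) {M : ℝ≥0∞}
    (hM : ∀ x : E, ∀ r : ℝ, 0 < r →
      ∫⁻ y in Metric.ball x r, g y ^ p ∂μ ≤ M * ENNReal.ofReal (r ^ lam)) (r : ℝ) (hr : 0 < r) :
    ∫⁻ y in Metric.ball 0 r, g y ∂μ ≤ M ^ (1 / p) * μ (Metric.ball 0 1) ^ (1 - 1 / p) *
      ENNReal.ofReal (r ^ (lam / p + Module.finrank ℝ E * (1 - 1 / p))) := by
  have hp0 : 0 < p := by linarith
  have h1p : 0 ≤ 1 - 1 / p := by rw [sub_nonneg, div_le_one hp0]; exact hp.le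
  refine (lintegral_le_lintegral_rpow_mul_measure_univ _ hp hg.aemeasurable).trans ?_
  rw [Measure.restrict_apply_univ, Measure.addHaar_ball_of_pos μ 0 hr]
  calc _ ≤ (M * ENNReal.ofReal (r ^ lam)) ^ (1 / p) *
        (ENNReal.ofReal (r ^ Module.finrank ℝ E) * μ (Metric.ball 0 1)) ^ (1 - 1 / p) := by
        gcongr
        exact hM 0 r hr
    _ = _ := by
        rw [ENNReal.mul_rpow_of_nonneg _ _ (by positivity), ENNReal.mul_rpow_of_nonneg _ _ h1p,
          ENNReal.ofReal_rpow_of_pos (by positivity), ENNReal.ofReal_rpow_of_pos (by positivity),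
          ← Real.rpow_mul hr.le, ← Real.rpow_natCast, ← Real.rpow_mul hr.le, Real.rpow_add hr,
          ENNReal.ofReal_mul (by positivity), mul_one_div]
        ring

/-- The part of the Stein-Weiss operator away from the diagonal is controlled pointwise. -/
theorem exists_far_part_le {p lam α β γ : ℝ} (hp : 1 < p)
    (hα : α < Module.finrank ℝ E * (1 - 1 / p)) (hlam : 0 < lam)
    (hβ : β < (Module.finrank ℝ E - lam) / p) (hαβ : α + β = γ) :
    ∃ C : ℝ≥0, ∀ (g : E → ℝ≥0∞), Measurable g → ∀ M : ℝ≥0∞,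
      (∀ x : E, ∀ r : ℝ, 0 < r →
        ∫⁻ y in Metric.ball x r, g y ^ p ∂μ ≤ M * ENNReal.ofReal (r ^ lam)) →
      ∀ x : E, x ≠ 0 → ENNReal.ofReal (‖x‖ ^ (-β)) *
        ∫⁻ y in {y | ‖x‖ / 2 < ‖x - y‖}, ENNReal.ofReal (‖x - y‖ ^ (γ - Module.finrank ℝ E)) *
          (ENNReal.ofReal (‖y‖ ^ (-α)) * g y) ∂μ ≤
        C * M ^ (1 / p) * ENNReal.ofReal (‖x‖ ^ ((lam - Module.finrank ℝ E) / p)) := by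
  set n : ℝ := (Module.finrank ℝ E : ℝ) with hn
  set κ : ℝ := lam / p + n * (1 - 1 / p) with hκ
  have hp0 : 0 < p := by linarith
  -- These are the two convergence conditions: `|y|^(-α) g` at the origin and `|y|^(-α+γ-n) g` at
  -- infinity. The second amounts to `β < (n - lam)/p`, because `κ = n - (n - lam)/p`. Together they
  -- force `γ < n`.
  have hκα : α < κ := by have : 0 < lam / p := by positivity
                         linarith
  have hκβ : κ < α + (n - γ) := by
    have : κ = n - (n - lam) / p := by rw [hκ]; field_simp; ring
    linarith
  by_cases hE : Nontrivial E
  swap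
  · rw [not_nontrivial_iff_subsingleton] at hE
    exact ⟨0, fun g _ M _ x hx => (hx (Subsingleton.elim _ _)).elim⟩
  obtain ⟨C₁, hC₁⟩ := exists_lintegral_ball_norm_rpow_mul_le (E := E) hκα
  obtain ⟨C₂, hC₂⟩ := exists_lintegral_compl_ball_norm_rpow_mul_le (E := E) hκβ
  have hfin : μ (Metric.ball 0 1) ^ (1 - 1 / p) ≠ ⊤ := by
    refine ENNReal.rpow_ne_top_of_nonneg ?_ measure_ball_lt_top.ne
    rw [sub_nonneg, div_le_one hp0]; exact hp.le
  refine ⟨(((1 / 2 : ℝ) ^ (γ - n)).toNNReal * C₁ + ((1 / 3 : ℝ) ^ (γ - n)).toNNReal * C₂) *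
    (μ (Metric.ball 0 1) ^ (1 - 1 / p)).toNNReal, fun g hg M hM x hx => ?_⟩
  have hx0 : 0 < ‖x‖ := norm_pos_iff.2 hx
  have hA := lintegral_ball_le_of_lintegral_rpow_le μ hp hg hM
  have h1 := hC₁ μ g _ hA ‖x‖ hx0
  have h2 := hC₂ μ g _ hA ‖x‖ hx0
  set A := M ^ (1 / p) * μ (Metric.ball 0 1) ^ (1 - 1 / p) with hAdef
  have hS : MeasurableSet {y : E | ‖x‖ / 2 < ‖x - y‖} :=
    measurableSet_lt measurable_const (by fun_prop)
  have hin : ∫⁻ y in {y | ‖x‖ / 2 < ‖x - y‖} ∩ Metric.ball 0 ‖x‖,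
      ENNReal.ofReal (‖x - y‖ ^ (γ - n)) * (ENNReal.ofReal (‖y‖ ^ (-α)) * g y) ∂μ ≤
      ENNReal.ofReal ((‖x‖ * (1 / 2)) ^ (γ - n)) * (C₁ * A * ENNReal.ofReal (‖x‖ ^ (κ - α))) := by
    calc _ ≤ ∫⁻ y in {y | ‖x‖ / 2 < ‖x - y‖} ∩ Metric.ball 0 ‖x‖,
          ENNReal.ofReal ((‖x‖ * (1 / 2)) ^ (γ - n)) * (ENNReal.ofReal (‖y‖ ^ (-α)) * g y) ∂μ := by
          refine setLIntegral_mono' (hS.inter measurableSet_ball) fun y hy => ?_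
          refine mul_le_mul_left (ENNReal.ofReal_le_ofReal ?_) _
          refine Real.rpow_le_rpow_of_nonpos (by positivity) ?_ (by linarith)
          linarith [hy.1.out]
      _ ≤ ∫⁻ y in Metric.ball 0 ‖x‖,
          ENNReal.ofReal ((‖x‖ * (1 / 2)) ^ (γ - n)) * (ENNReal.ofReal (‖y‖ ^ (-α)) * g y) ∂μ :=
          lintegral_mono_set Set.inter_subset_right
      _ ≤ _ := by
          rw [lintegral_const_mul' _ _ (by simp)]
          gcongr
  -- Here `‖y‖ ≤ ‖x‖ + ‖x-y‖ ≤ 3‖x-y‖`, so the kernel is absorbed into the power of `‖y‖`.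
  have hout : ∫⁻ y in {y | ‖x‖ / 2 < ‖x - y‖} \ Metric.ball 0 ‖x‖,
      ENNReal.ofReal (‖x - y‖ ^ (γ - n)) * (ENNReal.ofReal (‖y‖ ^ (-α)) * g y) ∂μ ≤
      ENNReal.ofReal ((1 / 3) ^ (γ - n)) *
        (C₂ * A * ENNReal.ofReal (‖x‖ ^ (κ - (α + (n - γ))))) := by
    calc _ ≤ ∫⁻ y in {y | ‖x‖ / 2 < ‖x - y‖} \ Metric.ball 0 ‖x‖,
          ENNReal.ofReal ((1 / 3) ^ (γ - n)) *
            (ENNReal.ofReal (‖y‖ ^ (-(α + (n - γ)))) * g y) ∂μ := by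
          refine setLIntegral_mono' (hS.diff measurableSet_ball) fun y hy => ?_
          have hy1 : ‖x‖ / 2 < ‖x - y‖ := hy.1
          have hy2 : ‖x‖ ≤ ‖y‖ := by simpa using hy.2
          have hy0 : 0 < ‖y‖ := hx0.trans_le hy2
          have hy3 : ‖y‖ ≤ ‖x‖ + ‖x - y‖ := by
            calc ‖y‖ = ‖x - (x - y)‖ := by simp
              _ ≤ _ := norm_sub_le _ _
          have : ‖x - y‖ ^ (γ - n) ≤ ((1 / 3) * ‖y‖) ^ (γ - n) :=
            Real.rpow_le_rpow_of_nonpos (by positivity) (by linarith) (by linarith)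
          rw [← mul_assoc, ← mul_assoc, ← ENNReal.ofReal_mul (by positivity),
            ← ENNReal.ofReal_mul (by positivity)]
          refine mul_le_mul_left (ENNReal.ofReal_le_ofReal ?_) _
          rw [show -(α + (n - γ)) = (γ - n) + -α by ring, Real.rpow_add hy0, ← mul_assoc,
            ← Real.mul_rpow (by norm_num) hy0.le]
          gcongr
      _ ≤ ∫⁻ y in (Metric.ball 0 ‖x‖)ᶜ,
          ENNReal.ofReal ((1 / 3) ^ (γ - n)) *
            (ENNReal.ofReal (‖y‖ ^ (-(α + (n - γ)))) * g y) ∂μ :=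
          lintegral_mono_set fun y hy => hy.2
      _ ≤ _ := by
          rw [lintegral_const_mul' _ _ (by simp)]
          gcongr
  rw [← lintegral_inter_add_sdiff _ {y | ‖x‖ / 2 < ‖x - y‖} (measurableSet_ball (x := (0 : E)))]
  refine (mul_le_mul_right (add_le_add hin hout) _).trans_eq ?_
  have e1 : ENNReal.ofReal (‖x‖ ^ (-β)) * (ENNReal.ofReal (‖x‖ ^ (γ - n)) *
      ENNReal.ofReal (‖x‖ ^ (κ - α))) = ENNReal.ofReal (‖x‖ ^ ((lam - n) / p)) := by
    rw [← ENNReal.ofReal_mul (by positivity), ← ENNReal.ofReal_mul (by positivity),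
      ← Real.rpow_add hx0, ← Real.rpow_add hx0]
    congr 2
    rw [hκ, ← hαβ]; field_simp; ring
  have e2 : ENNReal.ofReal (‖x‖ ^ (-β)) * ENNReal.ofReal (‖x‖ ^ (κ - (α + (n - γ)))) =
      ENNReal.ofReal (‖x‖ ^ ((lam - n) / p)) := by
    rw [← ENNReal.ofReal_mul (by positivity), ← Real.rpow_add hx0]
    congr 2
    rw [hκ, ← hαβ]; field_simp; ring
  rw [Real.mul_rpow hx0.le (by norm_num), ENNReal.ofReal_mul (by positivity), hAdef,
    ENNReal.coe_mul, ENNReal.coe_toNNReal hfin, ENNReal.coe_add, ENNReal.coe_mul, ENNReal.coe_mul]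
  simp only [ENNReal.ofReal] at e1 e2 ⊢
  rw [mul_add, add_mul, add_mul, add_mul]
  congr 1
  · rw [← e1]; ring
  · rw [← e2]; ring

theorem rieszBallMeasure_univ_lt_top [Nontrivial E] {γ : ℝ} (hγ : 0 < γ) :
    rieszBallMeasure μ γ Set.univ < ⊤ := by
  obtain ⟨C, hC⟩ := exists_lintegral_ball_zero_norm_rpow_le μ
    (σ := Module.finrank ℝ E - γ) (by linarith)
  rw [← lintegral_one, lintegral_rieszBallMeasure μ γ measurable_const]
  have h1 := hC 1 one_pos
  simp only [neg_sub] at h1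
  simp only [mul_one]
  exact ((lintegral_mono_set
    (Metric.closedBall_subset_ball (by norm_num : (1 / 2 : ℝ) < 1))).trans h1).trans_lt
    (ENNReal.mul_lt_top ENNReal.coe_lt_top ENNReal.ofReal_lt_top)

/-- On this region `‖y‖` is comparable to `‖x‖`, so the inner weight can be frozen. The substitution
`y = x - ‖x‖ • z` extracts `‖x‖^γ`, which cancels both weights since `α + β = γ`. -/
theorem near_part_le {α β γ : ℝ} (hαβ : α + β = γ) {g : E → ℝ≥0∞} (hg : Measurable g) {x : E}
    (hx : x ≠ 0) :
    ENNReal.ofReal (‖x‖ ^ (-β)) *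
        ∫⁻ y in {y | ‖x - y‖ ≤ ‖x‖ / 2}, ENNReal.ofReal (‖x - y‖ ^ (γ - Module.finrank ℝ E)) *
          (ENNReal.ofReal (‖y‖ ^ (-α)) * g y) ∂μ ≤
      ENNReal.ofReal (2 ^ |α|) * ∫⁻ z, g (x - ‖x‖ • z) ∂rieszBallMeasure μ γ := by
  have hx0 : 0 < ‖x‖ := norm_pos_iff.2 hx
  set n : ℝ := (Module.finrank ℝ E : ℝ) with hn
  have hS : MeasurableSet {y : E | ‖x - y‖ ≤ ‖x‖ / 2} :=
    measurableSet_le (by fun_prop) measurable_const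
  have h1 : ∫⁻ y in {y | ‖x - y‖ ≤ ‖x‖ / 2}, ENNReal.ofReal (‖x - y‖ ^ (γ - n)) *
      (ENNReal.ofReal (‖y‖ ^ (-α)) * g y) ∂μ ≤ ENNReal.ofReal (2 ^ |α| * ‖x‖ ^ (-α)) *
      ∫⁻ y in {y | ‖x - y‖ ≤ ‖x‖ / 2}, ENNReal.ofReal (‖x - y‖ ^ (γ - n)) * g y ∂μ := by
    rw [← lintegral_const_mul' _ _ (by simp)]
    refine setLIntegral_mono' hS fun y hy => ?_
    rw [mul_left_comm]
    refine mul_le_mul_left (ENNReal.ofReal_le_ofReal ?_) _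
    have hy : ‖x - y‖ ≤ ‖x‖ / 2 := hy
    have := norm_sub_norm_le x y
    have := norm_sub_norm_le y x
    rw [norm_sub_rev] at this
    exact rpow_neg_le_of_half_le hx0 (by linarith) (by linarith)
  have h2 : ∫⁻ y in {y | ‖x - y‖ ≤ ‖x‖ / 2}, ENNReal.ofReal (‖x - y‖ ^ (γ - n)) * g y ∂μ =
      ENNReal.ofReal (‖x‖ ^ γ) * ∫⁻ z, g (x - ‖x‖ • z) ∂rieszBallMeasure μ γ := by
    rw [← lintegral_indicator hS, ← lintegral_sub_left_eq_self _ x,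
      lintegral_comp_smul_haar μ hx0, lintegral_rieszBallMeasure _ _ (by fun_prop),
      ← lintegral_indicator measurableSet_closedBall, ← lintegral_const_mul' _ _ (by simp),
      ← lintegral_const_mul' _ _ (by simp)]
    refine lintegral_congr fun z => ?_
    by_cases hz : ‖z‖ ≤ 1 / 2
    · have : ‖x‖ * ‖z‖ ≤ ‖x‖ / 2 := by nlinarith
      rw [Set.indicator_of_mem (by simpa [norm_smul] using this),
        Set.indicator_of_mem (by simpa using hz), sub_sub_cancel, norm_smul, norm_norm,
        Real.mul_rpow hx0.le (norm_nonneg _), ENNReal.ofReal_mul (by positivity), ← mul_assoc,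
        ← mul_assoc, ← ENNReal.ofReal_mul (by positivity), ← Real.rpow_natCast,
        ← Real.rpow_add hx0, ← mul_assoc]
      congr 4
      ring
    · have : ¬ ‖x‖ * ‖z‖ ≤ ‖x‖ / 2 := by push Not at hz ⊢; nlinarith
      rw [Set.indicator_of_notMem (by simpa [norm_smul] using this),
        Set.indicator_of_notMem (by simpa using hz), mul_zero, mul_zero]
  refine (mul_le_mul_right (h1.trans_eq (congrArg _ h2)) _).trans_eq ?_
  rw [← mul_assoc, ← mul_assoc, ← ENNReal.ofReal_mul (by positivity),
    ← ENNReal.ofReal_mul (by positivity)]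
  congr 2
  rw [mul_left_comm, mul_assoc, ← Real.rpow_add hx0, ← Real.rpow_add hx0,
    ← hαβ]
  simp

/-- Hölder against the finite measure in `z` and Tonelli reduce the claim to one fixed `z`. The map
for that `z` sends `B(x,r)` into `B(x - ‖x‖ • z, 2r)` and is 2-antilipschitz, so the Morrey bound
for `g` on the larger ball suffices. -/
theorem exists_lintegral_near_part_rpow_le [Nontrivial E] {p lam γ : ℝ} (hp : 1 < p)
    (hγ : 0 < γ) :
    ∃ C : ℝ≥0, ∀ (g : E → ℝ≥0∞), Measurable g → ∀ M : ℝ≥0∞,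
      (∀ x : E, ∀ r : ℝ, 0 < r →
        ∫⁻ y in Metric.ball x r, g y ^ p ∂μ ≤ M * ENNReal.ofReal (r ^ lam)) →
      ∀ x : E, ∀ r : ℝ, 0 < r →
        ∫⁻ y in Metric.ball x r, (∫⁻ z, g (y - ‖y‖ • z) ∂rieszBallMeasure μ γ) ^ p ∂μ ≤
          C * M * ENNReal.ofReal (r ^ lam) := by
  obtain ⟨K, hK⟩ := AntilipschitzWith.exists_lintegral_comp_le μ 2
  set ν := rieszBallMeasure μ γ with hν
  have hfin := rieszBallMeasure_univ_lt_top μ hγ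
  have : IsFiniteMeasure ν := ⟨hfin⟩
  have hfin' : ν Set.univ ^ (p - 1) ≠ ⊤ := ENNReal.rpow_ne_top_of_nonneg (by linarith) hfin.ne
  refine ⟨(ν Set.univ ^ (p - 1)).toNNReal * (ν Set.univ).toNNReal * K * ((2 : ℝ) ^ lam).toNNReal,
    fun g hg M hM x r hr => ?_⟩
  have hz : ∀ᵐ z ∂ν, ‖z‖ ≤ 1 / 2 := by
    refine (withDensity_absolutelyContinuous _ _).ae_le ?_
    filter_upwards [ae_restrict_mem (measurableSet_closedBall (x := (0 : E)))] with z hz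
    simpa using hz
  calc ∫⁻ y in Metric.ball x r, (∫⁻ z, g (y - ‖y‖ • z) ∂ν) ^ p ∂μ
      ≤ ∫⁻ y in Metric.ball x r, ν Set.univ ^ (p - 1) * ∫⁻ z, g (y - ‖y‖ • z) ^ p ∂ν ∂μ :=
        lintegral_mono fun y => lintegral_rpow_le_mul_lintegral ν hp (by fun_prop)
    _ = ν Set.univ ^ (p - 1) * ∫⁻ z, ∫⁻ y in Metric.ball x r, g (y - ‖y‖ • z) ^ p ∂μ ∂ν := by
        rw [lintegral_const_mul' _ _ hfin', lintegral_lintegral_swap]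
        fun_prop
    _ ≤ ν Set.univ ^ (p - 1) * ∫⁻ _, K * (M * ENNReal.ofReal ((2 * r) ^ lam)) ∂ν := by
        refine mul_le_mul_right (lintegral_mono_ae ?_) _
        filter_upwards [hz] with z hz
        calc ∫⁻ y in Metric.ball x r, g (y - ‖y‖ • z) ^ p ∂μ
            ≤ ∫⁻ y, (Metric.ball (x - ‖x‖ • z) (2 * r)).indicator (fun y => g y ^ p)
                (y - ‖y‖ • z) ∂μ := by
              rw [← lintegral_indicator measurableSet_ball]
              refine lintegral_mono fun y => ?_
              by_cases hy : y ∈ Metric.ball x r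
              · rw [Set.indicator_of_mem hy, Set.indicator_of_mem]
                rw [Metric.mem_ball] at hy ⊢
                exact (dist_sub_norm_smul_le hz y x).trans_lt (by linarith)
              · simp [Set.indicator_of_notMem hy]
          _ ≤ K * ∫⁻ y, (Metric.ball (x - ‖x‖ • z) (2 * r)).indicator (fun y => g y ^ p) y ∂μ :=
              hK _ (by fun_prop) (antilipschitzWith_sub_norm_smul hz) _
                ((hg.pow_const p).indicator measurableSet_ball)
          _ ≤ K * (M * ENNReal.ofReal ((2 * r) ^ lam)) := by
              rw [lintegral_indicator measurableSet_ball]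
              gcongr
              exact hM _ _ (by positivity)
    _ = _ := by
        rw [lintegral_const, Real.mul_rpow (by norm_num) hr.le, ENNReal.ofReal_mul (by positivity)]
        push_cast
        rw [ENNReal.coe_toNNReal hfin', ENNReal.coe_toNNReal hfin.ne]
        simp only [ENNReal.ofReal]
        ring

/-- Stein-Weiss inequality on Morrey spaces, for the kernel
`‖x‖ ^ (-β) * ‖x - y‖ ^ (γ - n) * ‖y‖ ^ (-α)` with `α + β = γ`. -/
theorem exists_lintegral_steinWeiss_rpow_le [Nontrivial E] {p lam α β γ : ℝ} (hp : 1 < p)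
    (hα : α < Module.finrank ℝ E * (1 - 1 / p)) (hlam : 0 < lam) (hlam' : lam ≤ Module.finrank ℝ E)
    (hβ : β < (Module.finrank ℝ E - lam) / p) (hαβ : α + β = γ) (hγ0 : 0 < γ) :
    ∃ C : ℝ≥0, ∀ (g : E → ℝ≥0∞), Measurable g → ∀ M : ℝ≥0∞,
      (∀ x : E, ∀ r : ℝ, 0 < r →
        ∫⁻ y in Metric.ball x r, g y ^ p ∂μ ≤ M * ENNReal.ofReal (r ^ lam)) →
      ∀ x : E, ∀ r : ℝ, 0 < r →
        ∫⁻ y in Metric.ball x r, (ENNReal.ofReal (‖y‖ ^ (-β)) *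
          ∫⁻ z, ENNReal.ofReal (‖y - z‖ ^ (γ - Module.finrank ℝ E)) *
            (ENNReal.ofReal (‖z‖ ^ (-α)) * g z) ∂μ) ^ p ∂μ ≤
          C * M * ENNReal.ofReal (r ^ lam) := by
  have hp0 : 0 < p := by linarith
  obtain ⟨C₁, hC₁⟩ := exists_far_part_le μ hp hα hlam hβ hαβ
  obtain ⟨C₂, hC₂⟩ := exists_lintegral_near_part_rpow_le μ (lam := lam) hp hγ0
  obtain ⟨C₃, hC₃⟩ := exists_lintegral_ball_norm_rpow_le μ hlam hlam'
  have hK : (2 : ℝ≥0∞) ^ (p - 1) * (ENNReal.ofReal (2 ^ |α|) ^ p * C₂ + C₁ ^ p * C₃) ≠ ⊤ := by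
    refine ENNReal.mul_ne_top (ENNReal.rpow_ne_top_of_nonneg (by linarith) (by simp))
      (ENNReal.add_ne_top.2 ⟨ENNReal.mul_ne_top ?_ (by simp), ENNReal.mul_ne_top ?_ (by simp)⟩) <;>
    exact ENNReal.rpow_ne_top_of_nonneg hp0.le (by simp)
  refine ⟨((2 : ℝ≥0∞) ^ (p - 1) *
    (ENNReal.ofReal (2 ^ |α|) ^ p * C₂ + C₁ ^ p * C₃)).toNNReal, fun g hg M hM x r hr => ?_⟩
  have hpt : ∀ᵐ y ∂(μ.restrict (Metric.ball x r)), (ENNReal.ofReal (‖y‖ ^ (-β)) *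
          ∫⁻ z, ENNReal.ofReal (‖y - z‖ ^ (γ - Module.finrank ℝ E)) *
            (ENNReal.ofReal (‖z‖ ^ (-α)) * g z) ∂μ) ^ p ≤
      2 ^ (p - 1) * (ENNReal.ofReal (2 ^ |α|) ^ p *
        (∫⁻ z, g (y - ‖y‖ • z) ∂rieszBallMeasure μ γ) ^ p +
        C₁ ^ p * M * ENNReal.ofReal (‖y‖ ^ (lam - Module.finrank ℝ E))) := by
    have h0 : ∀ᵐ y ∂(μ.restrict (Metric.ball x r)), y ≠ 0 :=
      ae_restrict_of_ae (by simp [ae_iff, measure_singleton])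
    filter_upwards [h0] with y hy
    have hy0 : 0 < ‖y‖ := norm_pos_iff.2 hy
    have hS : MeasurableSet {z : E | ‖y - z‖ ≤ ‖y‖ / 2} :=
      measurableSet_le (by fun_prop) measurable_const
    rw [← lintegral_add_compl _ hS, mul_add,
      show {z : E | ‖y - z‖ ≤ ‖y‖ / 2}ᶜ = {z | ‖y‖ / 2 < ‖y - z‖} by ext; simp]
    refine (ENNReal.rpow_le_rpow (add_le_add (near_part_le μ hαβ hg hy) (hC₁ g hg M hM y hy))
      hp0.le).trans ((ENNReal.rpow_add_le_mul_rpow_add_rpow _ _ hp.le).trans_eq ?_)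
    rw [ENNReal.mul_rpow_of_nonneg _ _ hp0.le, ENNReal.mul_rpow_of_nonneg _ _ hp0.le,
      ENNReal.mul_rpow_of_nonneg _ _ hp0.le, ← ENNReal.rpow_mul, one_div_mul_cancel hp0.ne',
      ENNReal.rpow_one, ENNReal.ofReal_rpow_of_pos (p := p) (Real.rpow_pos_of_pos hy0 _),
      ← Real.rpow_mul hy0.le, div_mul_cancel₀ _ hp0.ne']
  refine (lintegral_mono_ae hpt).trans ?_
  rw [lintegral_const_mul' _ _ (by simp), lintegral_add_right _ (by fun_prop),
    lintegral_const_mul' _ _ (ENNReal.rpow_ne_top_of_nonneg hp0.le ENNReal.ofReal_ne_top),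
    lintegral_const_mul _ (by fun_prop)]
  calc _ ≤ (2 : ℝ≥0∞) ^ (p - 1) * (ENNReal.ofReal (2 ^ |α|) ^ p *
        (C₂ * M * ENNReal.ofReal (r ^ lam)) + C₁ ^ p * M * (C₃ * ENNReal.ofReal (r ^ lam))) := by
        gcongr
        · exact hC₂ g hg M hM x r hr
        · exact hC₃ x r hr
    _ = _ := by
        rw [ENNReal.coe_toNNReal hK]
        ring

end SteinWeiss

/-! ### From integral bounds to Morrey norms -/

theorem morreyNorm_le_of_forall_lintegral_le {N : ℕ} {p lam : ℝ} (hp : 0 < p)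
    {f : EuclideanSpace ℝ (Fin N) → ℝ} {A : ℝ≥0∞}
    (h : ∀ (x : EuclideanSpace ℝ (Fin N)) (r : ℝ), 0 < r →
      ∫⁻ y in Metric.ball x r, ‖f y‖ₑ ^ p ≤ A ^ p * ENNReal.ofReal (r ^ lam)) :
    morreyNorm p lam f ≤ A := by
  rw [morreyNorm, one_div, ENNReal.rpow_inv_le_iff hp]
  refine iSup_le fun x => iSup_le fun r => iSup_le fun hr => ?_
  refine (mul_le_mul_right (h x r hr) _).trans_eq ?_
  rw [mul_left_comm, ← ENNReal.ofReal_mul (by positivity), ← Real.rpow_add hr]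
  simp

theorem lintegral_ball_le_morreyNorm_rpow_mul {N : ℕ} {p lam : ℝ} (hp : 0 < p)
    (f : EuclideanSpace ℝ (Fin N) → ℝ) (x : EuclideanSpace ℝ (Fin N)) {r : ℝ} (hr : 0 < r) :
    ∫⁻ y in Metric.ball x r, ‖f y‖ₑ ^ p ≤ morreyNorm p lam f ^ p * ENNReal.ofReal (r ^ lam) := by
  have h : ENNReal.ofReal (r ^ (-lam)) * ∫⁻ y in Metric.ball x r, ‖f y‖ₑ ^ p ≤
      morreyNorm p lam f ^ p := by
    rw [morreyNorm, ← ENNReal.rpow_mul, one_div_mul_cancel hp.ne', ENNReal.rpow_one]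
    exact le_iSup_of_le x (le_iSup_of_le r (le_iSup_of_le hr le_rfl))
  refine le_trans (le_of_eq ?_) (mul_le_mul_left h _)
  rw [mul_right_comm, ← ENNReal.ofReal_mul (by positivity), ← Real.rpow_add hr]
  simp

/-- A function dominated by the Riesz potential of `|f|` of order `γ = α + β` satisfies a weighted
inequality in Morrey norms. -/
theorem exists_morreyNorm_le_of_le_rieszPotential {N : ℕ} (hN : 0 < N) {p lam α β γ : ℝ}
    (hp : 1 < p) (hα : α < N / p.conjExponent) (hlam : 0 < lam) (hlam' : lam ≤ N)
    (hβ : β < (N - lam) / p) (hαβ : α + β = γ) (hγ0 : 0 < γ) (K : ℝ≥0) :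
    ∃ C : ℝ≥0, 0 < C ∧ ∀ u f : EuclideanSpace ℝ (Fin N) → ℝ, Measurable f →
      (∀ x, ‖u x‖ₑ ≤ K * ∫⁻ y, ENNReal.ofReal (‖x - y‖ ^ (γ - N)) * ‖f y‖ₑ) →
      morreyNorm p lam (fun x => ‖x‖ ^ (-β) * u x) ≤
        C * morreyNorm p lam (fun x => ‖x‖ ^ α * f x) := by
  have hp0 : 0 < p := by linarith
  have : Nontrivial (EuclideanSpace ℝ (Fin N)) :=
    Module.nontrivial_of_finrank_pos (R := ℝ) (by simpa using hN)
  have hα' : α < Module.finrank ℝ (EuclideanSpace ℝ (Fin N)) * (1 - 1 / p) := by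
    rw [finrank_euclideanSpace_fin]
    convert hα using 1
    rw [Real.conjExponent]
    field_simp
  obtain ⟨C, hC⟩ := exists_lintegral_steinWeiss_rpow_le
    (volume : Measure (EuclideanSpace ℝ (Fin N))) hp hα' hlam (by simpa using hlam')
    (by simpa using hβ) hαβ hγ0
  rw [finrank_euclideanSpace_fin] at hC
  -- The summand 1 only keeps the constant positive when `K` or `C` vanishes.
  refine ⟨K * C ^ (1 / p) + 1, by positivity, fun u f hf huf => ?_⟩
  set B := morreyNorm p lam (fun x => ‖x‖ ^ α * f x) with hB
  set g : EuclideanSpace ℝ (Fin N) → ℝ≥0∞ := fun y => ‖‖y‖ ^ α * f y‖ₑ with hg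
  have hgm : Measurable g := by fun_prop
  refine le_trans (b := K * C ^ (1 / p) * B) ?_ ?_
  · refine morreyNorm_le_of_forall_lintegral_le hp0 fun x r hr => ?_
    have hpt : ∀ y, ‖‖y‖ ^ (-β) * u y‖ₑ ^ p ≤ (K : ℝ≥0∞) ^ p * (ENNReal.ofReal (‖y‖ ^ (-β)) *
          ∫⁻ z, ENNReal.ofReal (‖y - z‖ ^ (γ - N)) *
            (ENNReal.ofReal (‖z‖ ^ (-α)) * g z)) ^ p := by
      intro y
      rw [← ENNReal.mul_rpow_of_nonneg _ _ hp0.le]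
      gcongr
      rw [enorm_mul, Real.enorm_eq_ofReal (by positivity), mul_left_comm]
      gcongr
      refine (huf y).trans_eq ?_
      congr 1
      refine lintegral_congr_ae ?_
      have h0 : ∀ᵐ z : EuclideanSpace ℝ (Fin N), z ≠ 0 := by simp [ae_iff, measure_singleton]
      filter_upwards [h0] with z hz
      have hz0 : 0 < ‖z‖ := norm_pos_iff.2 hz
      congr 1
      rw [hg]
      dsimp only
      rw [enorm_mul, Real.enorm_eq_ofReal (by positivity : 0 ≤ ‖z‖ ^ α), ← mul_assoc,
        ← ENNReal.ofReal_mul (by positivity), ← Real.rpow_add hz0]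
      simp
    refine (lintegral_mono hpt).trans ?_
    rw [lintegral_const_mul' _ _ (ENNReal.rpow_ne_top_of_nonneg hp0.le ENNReal.coe_ne_top)]
    refine (mul_le_mul_right (hC g hgm (B ^ p) (fun x r hr =>
      lintegral_ball_le_morreyNorm_rpow_mul hp0 _ x hr) x r hr) _).trans_eq ?_
    rw [ENNReal.mul_rpow_of_nonneg _ _ hp0.le, ENNReal.mul_rpow_of_nonneg _ _ hp0.le,
      ← ENNReal.rpow_mul, one_div_mul_cancel hp0.ne', ENNReal.rpow_one]
    ring
  · gcongr
    rw [ENNReal.coe_add, ENNReal.coe_mul, ← ENNReal.coe_rpow_of_nonneg _ (by positivity)]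
    exact le_self_add

/-! ### The truncated paraboloid -/

/-- Squaring the positive part removes its kink. Hence the squared bump is differentiable across the
unit sphere and integration by parts yields no boundary term. -/
theorem hasDerivAt_max_zero_sq (t : ℝ) : HasDerivAt (fun s : ℝ => max 0 s ^ 2) (2 * max 0 t) t := by
  rcases lt_trichotomy t 0 with h | rfl | h
  · rw [max_eq_left h.le, mul_zero]
    refine (hasDerivAt_const t (0 : ℝ)).congr_of_eventuallyEq ?_
    filter_upwards [eventually_lt_nhds h] with s hs
    simp [max_eq_left hs.le]
  · rw [max_self, mul_zero, hasDerivAt_iff_tendsto_slope_zero]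
    have h1 : Tendsto (fun t : ℝ => |t|) (𝓝[≠] 0) (𝓝 0) := by
      simpa using (continuous_abs.tendsto (0 : ℝ)).mono_left nhdsWithin_le_nhds
    refine squeeze_zero_norm (fun t => ?_) h1
    rcases eq_or_ne t 0 with rfl | ht
    · simp
    · have h3 : |max 0 t| ≤ |t| := by
        rcases le_total 0 t with h | h
        · rw [max_eq_right h]
        · rw [max_eq_left h, abs_zero]; positivity
      have ht' : 0 < |t| := abs_pos.2 ht
      simp only [zero_add, max_self, smul_eq_mul, Real.norm_eq_abs, abs_mul, abs_inv, ne_eq,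
        OfNat.ofNat_ne_zero, not_false_eq_true, zero_pow, sub_zero, abs_pow]
      rw [inv_mul_le_iff₀ ht', ← sq]
      gcongr
  · rw [max_eq_right h.le]
    refine (by simpa using hasDerivAt_pow 2 t : HasDerivAt (fun s : ℝ => s ^ 2) (2 * t) t
      ).congr_of_eventuallyEq ?_
    filter_upwards [eventually_gt_nhds h] with s hs
    simp [max_eq_right hs.le]

section Kernel

variable {E : Type*} [NormedAddCommGroup E]

/-- The truncated paraboloid `(1 - ‖y‖²)₊`. -/
def parabolicBump (y : E) : ℝ := max 0 (1 - ‖y‖ ^ 2)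

theorem continuous_parabolicBump : Continuous (parabolicBump : E → ℝ) := by
  unfold parabolicBump; fun_prop

theorem parabolicBump_nonneg (y : E) : 0 ≤ parabolicBump y := le_max_left _ _

theorem parabolicBump_le_one (y : E) : parabolicBump y ≤ 1 :=
  max_le zero_le_one (by linarith [sq_nonneg ‖y‖])

theorem parabolicBump_eq_zero {y : E} (hy : 1 ≤ ‖y‖) : parabolicBump y = 0 :=
  max_eq_left (by nlinarith)

theorem hasCompactSupport_parabolicBump [ProperSpace E] :
    HasCompactSupport (parabolicBump : E → ℝ) :=
  HasCompactSupport.intro (isCompact_closedBall 0 1) fun y hy =>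
    parabolicBump_eq_zero (by simpa using (not_le.1 (by simpa using hy)).le)

theorem hasFDerivAt_parabolicBump_sq [InnerProductSpace ℝ E] (y : E) :
    HasFDerivAt (fun y : E => parabolicBump y ^ 2) ((-(4 * parabolicBump y)) • innerSL ℝ y) y := by
  have h1 : HasFDerivAt (fun y : E => 1 - ‖y‖ ^ 2) (-(2 • innerSL ℝ y)) y := by
    simpa using ((hasFDerivAt_id y).norm_sq).const_sub 1
  have h2 := (hasDerivAt_max_zero_sq (1 - ‖y‖ ^ 2)).comp_hasFDerivAt y h1
  refine HasFDerivAt.congr_fderiv (f := fun y : E => parabolicBump y ^ 2) h2 ?_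
  ext v
  simp [parabolicBump]
  ring

end Kernel

/-! ### Newtonian potential bound from averages over dilations -/

section Representation

variable {E : Type*} [NormedAddCommGroup E] [InnerProductSpace ℝ E]

theorem hasFDerivAt_fderiv_comp_line {u : E → ℝ} (hu : ContDiff ℝ 2 u) (x v : E) (t : ℝ) (y : E) :
    HasFDerivAt (fun y => fderiv ℝ u (x + t • y) v)
      (t • (fderiv ℝ (fderiv ℝ u) (x + t • y)).flip v) y := by
  have h1 : ContDiff ℝ 1 (fderiv ℝ u) := hu.fderiv_right (by norm_num)
  have h2 : HasFDerivAt (fun y : E => x + t • y) (t • ContinuousLinearMap.id ℝ E) y :=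
    ((hasFDerivAt_id y).const_smul t).const_add x
  have h3 := ((h1.differentiable (by norm_num) (x + t • y)).hasFDerivAt.comp y h2).clm_apply
    (hasFDerivAt_const v y)
  refine HasFDerivAt.congr_fderiv (f := fun y => fderiv ℝ u (x + t • y) v) h3 ?_
  ext w
  simp

variable [FiniteDimensional ℝ E]

theorem continuous_laplacian {u : E → ℝ} (hu : ContDiff ℝ 2 u) : Continuous (Δ u) := by
  rw [InnerProductSpace.laplacian_eq_iteratedFDeriv_stdOrthonormalBasis]
  have hc2 : Continuous (fderiv ℝ (fderiv ℝ u)) :=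
    (hu.fderiv_right (m := 1) (by norm_num)).continuous_fderiv (by norm_num)
  simp only [iteratedFDeriv_two_apply]
  fun_prop

variable [MeasurableSpace E] [BorelSpace E]

/-- Since `w(y) y = -∇(w²)/4` for the bump `w`, integration by parts in each coordinate of an
orthonormal basis moves the derivative onto `∇u(x+ty)`; the chain rule supplies the factor `t`. -/
theorem integral_parabolicBump_mul_fderiv {u : E → ℝ} (hu : ContDiff ℝ 2 u) (x : E) (t : ℝ) :
    ∫ y, parabolicBump y * fderiv ℝ u (x + t • y) y =
      t / 4 * ∫ y, parabolicBump y ^ 2 * Δ u (x + t • y) := by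
  set b := stdOrthonormalBasis ℝ E
  have hc1 : Continuous (fderiv ℝ u) := hu.continuous_fderiv (by norm_num)
  have hc2 : Continuous (fderiv ℝ (fderiv ℝ u)) :=
    (hu.fderiv_right (m := 1) (by norm_num)).continuous_fderiv (by norm_num)
  have hw : Continuous (parabolicBump : E → ℝ) := continuous_parabolicBump
  have hws : HasCompactSupport (parabolicBump : E → ℝ) := hasCompactSupport_parabolicBump
  have hws2 : HasCompactSupport (fun y : E => parabolicBump y ^ 2) := by
    simp only [sq]
    exact hws.mul_right
  have key : ∀ i, ∫ y, parabolicBump y * (inner ℝ (b i) y * fderiv ℝ u (x + t • y) (b i)) =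
      t / 4 * ∫ y, parabolicBump y ^ 2 * fderiv ℝ (fderiv ℝ u) (x + t • y) (b i) (b i) := by
    intro i
    have hf : ∀ y : E, fderiv ℝ (fun y : E => parabolicBump y ^ 2) y (b i) =
        -(4 * parabolicBump y) * inner ℝ (b i) y := by
      intro y
      rw [(hasFDerivAt_parabolicBump_sq y).fderiv]
      simp [real_inner_comm]
    have hg : ∀ y : E, fderiv ℝ (fun y => fderiv ℝ u (x + t • y) (b i)) y (b i) =
        t * fderiv ℝ (fderiv ℝ u) (x + t • y) (b i) (b i) := by
      intro y
      rw [(hasFDerivAt_fderiv_comp_line hu x (b i) t y).fderiv]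
      simp
    have h := integral_mul_fderiv_eq_neg_fderiv_mul_of_integrable (μ := (volume : Measure E))
      (f := fun y : E => parabolicBump y ^ 2)
      (g := fun y => fderiv ℝ u (x + t • y) (b i)) (v := b i) ?_ ?_ ?_
      (fun y _ => (hasFDerivAt_parabolicBump_sq y).differentiableAt)
      (fun y _ => (hasFDerivAt_fderiv_comp_line hu x (b i) t y).differentiableAt)
    · simp only [hf, hg] at h
      rw [← integral_neg] at h
      have e1 : ∫ y, parabolicBump y ^ 2 * (t * fderiv ℝ (fderiv ℝ u) (x + t • y) (b i) (b i)) =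
          t * ∫ y, parabolicBump y ^ 2 * fderiv ℝ (fderiv ℝ u) (x + t • y) (b i) (b i) := by
        rw [← integral_const_mul]
        congr 1; ext y; ring
      have e2 : ∫ y, -(-(4 * parabolicBump y) * inner ℝ (b i) y * fderiv ℝ u (x + t • y) (b i)) =
          4 * ∫ y, parabolicBump y * (inner ℝ (b i) y * fderiv ℝ u (x + t • y) (b i)) := by
        rw [← integral_const_mul]
        congr 1; ext y; ring
      rw [e1, e2] at h
      linarith
    · simp only [hf, mul_assoc, neg_mul]
      exact (Continuous.integrable_of_hasCompactSupport (by fun_prop) hws.mul_right).const_mul 4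
        |>.neg
    · simp only [hg]
      exact Continuous.integrable_of_hasCompactSupport (by fun_prop) hws2.mul_right
    · exact Continuous.integrable_of_hasCompactSupport (by fun_prop) hws2.mul_right
  have h1 : ∀ y : E, parabolicBump y * fderiv ℝ u (x + t • y) y =
      ∑ i, parabolicBump y * (inner ℝ (b i) y * fderiv ℝ u (x + t • y) (b i)) := by
    intro y
    rw [← Finset.mul_sum]
    congr 1
    conv_lhs => rw [← b.sum_repr' y]
    -- The expansion of `y` also entered the base point of the derivative; naming the derivative
    -- lets it be undone there while linearity is used in the argument.
    generalize hL : fderiv ℝ u (x + t • ∑ i, inner ℝ (b i) y • b i) = L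
    rw [b.sum_repr' y] at hL
    rw [hL, map_sum]
    simp
  have h2 : ∀ y : E, parabolicBump y ^ 2 * Δ u (x + t • y) =
      ∑ i, parabolicBump y ^ 2 * fderiv ℝ (fderiv ℝ u) (x + t • y) (b i) (b i) := by
    intro y
    rw [InnerProductSpace.laplacian_eq_iteratedFDeriv_stdOrthonormalBasis, Finset.mul_sum]
    simp [iteratedFDeriv_two_apply, b]
  simp only [h1, h2]
  rw [integral_finsetSum, integral_finsetSum, Finset.mul_sum]
  · exact Finset.sum_congr rfl fun i _ => key i
  · intro i _
    exact Continuous.integrable_of_hasCompactSupport (by fun_prop) hws2.mul_right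
  · intro i _
    exact Continuous.integrable_of_hasCompactSupport (by fun_prop) hws.mul_right

/-- Fundamental theorem of calculus along the dilations `t ↦ x + t • y`, with Fubini to exchange `t`
and `y`. -/
theorem integral_parabolicBump_mul_sub {u : E → ℝ} (hu : ContDiff ℝ 2 u) (x : E) {R : ℝ}
    (hR : 0 ≤ R) :
    ∫ y, parabolicBump y * (u (x + R • y) - u x) =
      ∫ t in Set.Ioc 0 R, t / 4 * ∫ y, parabolicBump y ^ 2 * Δ u (x + t • y) := by
  have hc1 : Continuous (fderiv ℝ u) := hu.continuous_fderiv (by norm_num)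
  have hw : Continuous (parabolicBump : E → ℝ) := continuous_parabolicBump
  have hF : Continuous (Function.uncurry fun (t : ℝ) (y : E) =>
      parabolicBump y * fderiv ℝ u (x + t • y) y) := by
    unfold Function.uncurry; fun_prop
  have hint : Integrable (Function.uncurry fun (t : ℝ) (y : E) =>
      parabolicBump y * fderiv ℝ u (x + t • y) y)
      ((volume.restrict (Set.uIoc 0 R)).prod (volume : Measure E)) := by
    have h1 : IntegrableOn (Function.uncurry fun (t : ℝ) (y : E) =>
        parabolicBump y * fderiv ℝ u (x + t • y) y)
        (Set.uIcc 0 R ×ˢ Metric.closedBall 0 1) ((volume : Measure ℝ).prod (volume : Measure E)) :=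
      hF.continuousOn.integrableOn_compact (isCompact_uIcc.prod (isCompact_closedBall 0 1))
    have h2 := h1.of_forall_sdiff_eq_zero (t := Set.uIcc 0 R ×ˢ Set.univ)
      (measurableSet_uIcc.prod MeasurableSet.univ) (by
        rintro ⟨t, y⟩ ⟨⟨ht, -⟩, h⟩
        have : ¬ ‖y‖ ≤ 1 := fun hy => h ⟨ht, by simpa using hy⟩
        simp [Function.uncurry, parabolicBump_eq_zero (not_le.1 this).le])
    have h3 := h2.mono_set (Set.prod_mono (Set.uIoc_subset_uIcc) (Set.Subset.refl _))
    rwa [IntegrableOn, ← Measure.prod_restrict, Measure.restrict_univ] at h3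
  rw [← intervalIntegral.integral_of_le hR]
  simp only [← integral_parabolicBump_mul_fderiv hu]
  rw [intervalIntegral_integral_swap hint]
  congr 1
  ext y
  rw [intervalIntegral.integral_const_mul]
  congr 1
  rw [intervalIntegral.integral_eq_sub_of_hasDerivAt (f := fun t : ℝ => u (x + t • y))]
  · simp
  · intro t _
    have h2 : HasDerivAt (fun t : ℝ => x + t • y) y t := by
      simpa using ((hasDerivAt_id t).smul_const y).const_add x
    exact (hu.differentiable (by norm_num) _).hasFDerivAt.comp_hasDerivAt t h2
  · exact Continuous.intervalIntegrable (by fun_prop) _ _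

theorem lintegral_Ioi_rpow_le {a s : ℝ} (ha : 0 < a) (hs : s < -1) :
    ∫⁻ t in Set.Ioi a, ENNReal.ofReal (t ^ s) = ENNReal.ofReal (a ^ (s + 1) / (-(s + 1))) := by
  rw [← ofReal_integral_eq_lintegral_ofReal (integrableOn_Ioi_rpow_of_lt hs ha),
    integral_Ioi_rpow_of_lt hs ha]
  · rw [div_neg, neg_div]
  · filter_upwards [ae_restrict_mem measurableSet_Ioi] with t ht
    exact Real.rpow_nonneg (ha.le.trans (le_of_lt ht)) _

/-- After bounding the bump by the indicator of the unit ball and rescaling `z = t y`, the kernel is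
at most the integral of `t^(1-n)` over `t > ‖z‖`, that is `‖z‖^(2-n)/(n-2)`. -/
theorem lintegral_dilation_parabolicBump_le [Nontrivial E] (hn : 2 < Module.finrank ℝ E)
    {h : E → ℝ≥0∞} (hh : Measurable h) (x : E) :
    ∫⁻ t in Set.Ioi (0 : ℝ), ENNReal.ofReal (t / 4) *
        ∫⁻ y, ENNReal.ofReal (parabolicBump y ^ 2) * h (x + t • y) ≤
      ∫⁻ z, ENNReal.ofReal (‖x - z‖ ^ (2 - Module.finrank ℝ E : ℝ)) * h z := by
  set n := Module.finrank ℝ E with hn'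
  have hn2 : (2 : ℝ) < n := by exact_mod_cast hn
  -- Integrality of the dimension gives `n - 2 ≥ 1`, so the denominator `n - 2` can be dropped.
  have hn3 : (3 : ℝ) ≤ n := by exact_mod_cast hn
  calc _ ≤ ∫⁻ t in Set.Ioi (0 : ℝ), ∫⁻ z, (if ‖z‖ < t then ENNReal.ofReal (t ^ (1 - n : ℝ)) else 0) *
          h (x + z) := by
        refine setLIntegral_mono' measurableSet_Ioi fun t ht => ?_
        have ht : 0 < t := ht
        rw [lintegral_comp_smul_haar volume ht fun z =>
            (if ‖z‖ < t then ENNReal.ofReal (t ^ (1 - n : ℝ)) else 0) * h (x + z), ← lintegral_const_mul' _ _ (by simp),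
          ← lintegral_const_mul' _ _ (by simp)]
        refine lintegral_mono fun y => ?_
        rw [← mul_assoc, ← mul_assoc]
        gcongr ?_ * _
        rw [norm_smul, Real.norm_of_nonneg ht.le]
        by_cases hy : 1 ≤ ‖y‖
        · simp [parabolicBump_eq_zero hy]
        · push Not at hy
          rw [if_pos (by nlinarith), ← ENNReal.ofReal_mul (by positivity),
            ← ENNReal.ofReal_mul (by positivity)]
          refine ENNReal.ofReal_le_ofReal ?_
          have h1 : parabolicBump y ^ 2 ≤ 1 :=
            pow_le_one₀ (parabolicBump_nonneg y) (parabolicBump_le_one y)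
          rw [← Real.rpow_natCast t, ← Real.rpow_add ht, add_sub_cancel, Real.rpow_one]
          nlinarith
    _ = ∫⁻ z, h (x + z) * ∫⁻ t in Set.Ioi (0 : ℝ),
          (if ‖z‖ < t then ENNReal.ofReal (t ^ (1 - n : ℝ)) else 0) := by
        rw [lintegral_lintegral_swap]
        · refine lintegral_congr fun z => ?_
          rw [mul_comm, lintegral_mul_const]
          exact Measurable.ite (measurableSet_lt measurable_const measurable_id) (by fun_prop)
            measurable_const
        · refine Measurable.aemeasurable ?_
          refine Measurable.mul (Measurable.ite (measurableSet_lt (by fun_prop) (by fun_prop))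
            (by fun_prop) measurable_const) (by fun_prop)
    _ ≤ ∫⁻ z, h (x + z) * ENNReal.ofReal (‖z‖ ^ (2 - n : ℝ)) := by
        refine lintegral_mono_ae ?_
        have h0 : ∀ᵐ z : E, z ≠ 0 := by simp [ae_iff, measure_singleton]
        filter_upwards [h0] with z hz
        have hz0 : 0 < ‖z‖ := norm_pos_iff.2 hz
        gcongr
        calc _ ≤ ∫⁻ t in Set.Ioi ‖z‖, ENNReal.ofReal (t ^ (1 - n : ℝ)) := by
              rw [← lintegral_indicator (measurableSet_Ioi (a := ‖z‖))]
              refine (setLIntegral_le_lintegral _ _).trans (lintegral_mono fun t => ?_)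
              simp [Set.indicator]
          _ ≤ _ := by
              rw [lintegral_Ioi_rpow_le hz0 (by linarith)]
              refine ENNReal.ofReal_le_ofReal ?_
              rw [show (1 - n + 1 : ℝ) = 2 - n by ring]
              exact div_le_self (by positivity) (by linarith)
    _ = _ := by
        rw [← lintegral_add_left_eq_self (fun z => ENNReal.ofReal (‖x - z‖ ^ (2 - n : ℝ)) * h z) x]
        simp [mul_comm]

/-- The bump is at most 1 and supported in the unit ball, so the integral is bounded by `R^(-n)`
times the integral of `|u|` over `B(0, R + ‖x‖)`. Once `R ≥ ‖x‖`, the radius is at most `2R`, and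
the normalizations are comparable. -/
theorem tendsto_integral_parabolicBump_mul_of_average {u : E → ℝ} (hu : Continuous u)
    (hav : Tendsto (fun R : ℝ => ⨍ y in Metric.ball (0 : E) R, |u y|) atTop (𝓝 0)) (x : E) :
    Tendsto (fun R : ℝ => ∫ y, parabolicBump y * u (x + R • y)) atTop (𝓝 0) := by
  set n := Module.finrank ℝ E with hn
  have h1 : Tendsto (fun R : ℝ => 2 ^ n * volume.real (Metric.ball (0 : E) 1) *
      ⨍ y in Metric.ball (0 : E) (R + ‖x‖), |u y|) atTop (𝓝 0) := by
    simpa using (hav.comp (tendsto_atTop_add_const_right atTop ‖x‖ tendsto_id)).const_mul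
      (2 ^ n * volume.real (Metric.ball (0 : E) 1))
  refine squeeze_zero_norm' ?_ h1
  filter_upwards [eventually_gt_atTop 0, eventually_ge_atTop ‖x‖] with R hR hRx
  set ρ := R + ‖x‖ with hρ
  have hρ0 : 0 < ρ := by positivity
  have hint : IntegrableOn (fun y => |u y|) (Metric.ball (0 : E) ρ) :=
    (hu.abs.continuousOn.integrableOn_compact (isCompact_closedBall 0 ρ)).mono_set
      Metric.ball_subset_closedBall
  set F : E → ℝ := (Metric.ball (0 : E) ρ).indicator fun y => |u y| with hF
  have hFi : Integrable F := (integrable_indicator_iff measurableSet_ball).2 hint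
  have hFi' : Integrable fun y => F (x + R • y) :=
    (hFi.comp_add_left x).comp_smul hR.ne'
  calc ‖∫ y, parabolicBump y * u (x + R • y)‖
      ≤ ∫ y, F (x + R • y) := by
        refine norm_integral_le_of_norm_le hFi' (ae_of_all _ fun y => ?_)
        rw [norm_mul, Real.norm_of_nonneg (parabolicBump_nonneg y), Real.norm_eq_abs]
        by_cases hy : 1 ≤ ‖y‖
        · rw [parabolicBump_eq_zero hy, zero_mul]
          exact Set.indicator_nonneg (fun _ _ => abs_nonneg _) _
        · push Not at hy
          rw [hF, Set.indicator_of_mem]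
          · exact mul_le_of_le_one_left (abs_nonneg _) (parabolicBump_le_one y)
          · rw [mem_ball_zero_iff]
            refine (norm_add_le _ _).trans_lt ?_
            rw [norm_smul, Real.norm_of_nonneg hR.le]
            nlinarith
    _ = (R ^ n)⁻¹ * ∫ y in Metric.ball (0 : E) ρ, |u y| := by
        rw [Measure.integral_comp_smul volume (fun y => F (x + y)) R,
          integral_add_left_eq_self F x, abs_of_nonneg (by positivity), smul_eq_mul,
          integral_indicator measurableSet_ball]
    _ = (R ^ n)⁻¹ * (ρ ^ n * volume.real (Metric.ball (0 : E) 1) *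
          ⨍ y in Metric.ball (0 : E) ρ, |u y|) := by
        have hv : volume.real (Metric.ball (0 : E) ρ) =
            ρ ^ n * volume.real (Metric.ball (0 : E) 1) := by
          rw [measureReal_def, Measure.addHaar_ball_of_pos _ _ hρ0, ENNReal.toReal_mul,
            ENNReal.toReal_ofReal (by positivity), measureReal_def]
        have hv0 : 0 < volume.real (Metric.ball (0 : E) ρ) :=
          ENNReal.toReal_pos (Metric.measure_ball_pos _ _ hρ0).ne' measure_ball_lt_top.ne
        rw [setAverage_eq, ← hv, smul_eq_mul, mul_inv_cancel_left₀ hv0.ne']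
    _ ≤ _ := by
        have hav0 : 0 ≤ ⨍ y in Metric.ball (0 : E) ρ, |u y| := by
          rw [setAverage_eq]
          exact smul_nonneg (by positivity) (integral_nonneg fun _ => abs_nonneg _)
        rw [mul_assoc, mul_assoc, ← mul_assoc]
        gcongr
        rw [inv_mul_le_iff₀ (by positivity), ← mul_pow]
        gcongr
        linarith

/-- A `C²` function that vanishes at infinity in mean is bounded by the Newtonian potential of its
Laplacian. -/
theorem exists_enorm_le_newtonPotential_laplacian (hn : 2 < Module.finrank ℝ E) :
    ∃ K : ℝ≥0, ∀ u : E → ℝ, ContDiff ℝ 2 u →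
      Tendsto (fun R : ℝ => ⨍ y in Metric.ball (0 : E) R, |u y|) atTop (𝓝 0) →
      ∀ x, ‖u x‖ₑ ≤
        K * ∫⁻ y, ENNReal.ofReal (‖x - y‖ ^ (2 - Module.finrank ℝ E : ℝ)) * ‖Δ u y‖ₑ := by
  have : Nontrivial E := Module.nontrivial_of_finrank_pos (R := ℝ) (by linarith)
  have hw : Continuous (parabolicBump : E → ℝ) := continuous_parabolicBump
  have hws : HasCompactSupport (parabolicBump : E → ℝ) := hasCompactSupport_parabolicBump
  set c := ∫ y : E, parabolicBump y with hc
  have hc0 : 0 < c := hw.integral_pos_of_hasCompactSupport_nonneg_nonzero (x := 0) hws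
    parabolicBump_nonneg (by simp [parabolicBump])
  refine ⟨‖c‖₊⁻¹, fun u hu hav x => ?_⟩
  have hΔ : Continuous (Δ u) := continuous_laplacian hu
  set I := ∫⁻ y, ENNReal.ofReal (‖x - y‖ ^ (2 - Module.finrank ℝ E : ℝ)) * ‖Δ u y‖ₑ with hI
  -- The term `I` does not depend on `R`, so letting `R → ∞` removes the average of `u`. In `[0,∞]`
  -- the case `I = ∞` needs no separate treatment.
  have hbound : ∀ R : ℝ, 0 < R →
      ‖c * u x‖ₑ ≤ ‖∫ y, parabolicBump y * u (x + R • y)‖ₑ + I := by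
    intro R hR
    have hsub := integral_parabolicBump_mul_sub hu x hR.le
    have huc := hu.continuous
    simp only [mul_sub] at hsub
    have hi1 : Integrable fun y : E => parabolicBump y * u (x + R • y) :=
      Continuous.integrable_of_hasCompactSupport (by fun_prop) hws.mul_right
    have hi2 : Integrable fun y : E => parabolicBump y * u x :=
      Continuous.integrable_of_hasCompactSupport (by fun_prop) hws.mul_right
    rw [integral_sub hi1 hi2, integral_mul_const] at hsub
    have e : c * u x = (∫ y, parabolicBump y * u (x + R • y)) -
        ∫ t in Set.Ioc 0 R, t / 4 * ∫ y, parabolicBump y ^ 2 * Δ u (x + t • y) := by linarith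
    rw [e]
    refine (enorm_sub_le).trans ?_
    gcongr
    refine (enorm_integral_le_lintegral_enorm _).trans
      (le_trans ?_ (lintegral_dilation_parabolicBump_le hn hΔ.measurable.enorm x))
    refine (lintegral_mono_set Set.Ioc_subset_Ioi_self).trans
      (setLIntegral_mono' measurableSet_Ioi fun t ht => ?_)
    have ht : 0 < t := ht
    rw [enorm_mul, Real.enorm_eq_ofReal (by positivity)]
    gcongr
    refine (enorm_integral_le_lintegral_enorm _).trans (lintegral_mono fun y => ?_)
    rw [enorm_mul, Real.enorm_eq_ofReal (by positivity)]
  have hlim : Tendsto (fun R : ℝ => ‖∫ y, parabolicBump y * u (x + R • y)‖ₑ + I) atTop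
      (𝓝 (0 + I)) := by
    refine Tendsto.add_const I ?_
    have h := (continuous_enorm.tendsto _).comp
      (tendsto_integral_parabolicBump_mul_of_average hu.continuous hav x)
    rwa [enorm_zero] at h
  have hfin := ge_of_tendsto hlim (by
    filter_upwards [eventually_gt_atTop 0] with R hR using hbound R hR)
  rw [zero_add, enorm_mul] at hfin
  have hc1 : ‖c‖₊ ≠ 0 := by simpa using hc0.ne'
  rw [ENNReal.coe_inv hc1]
  rw [mul_comm, ← div_eq_mul_inv, ENNReal.le_div_iff_mul_le (by simp [hc1]) (by simp), mul_comm]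
  exact hfin

end Representation

/-! ### Second differences as a Fourier multiplier -/

section Integrand

variable {E : Type*} [NormedAddCommGroup E] [InnerProductSpace ℝ E]

theorem two_sub_two_mul_cos_nonneg (t : ℝ) : 0 ≤ 2 - 2 * Real.cos t := by
  linarith [Real.cos_le_one t]

/-- The integrand of the Lévy-Khintchine formula for `‖ξ‖ ^ (2 * s)`. -/
noncomputable def fracSymbolIntegrand (s : ℝ) (ξ y : E) : ℝ :=
  (2 - 2 * Real.cos (2 * Real.pi * inner ℝ ξ y)) * ‖y‖ ^ (-(Module.finrank ℝ E + 2 * s : ℝ))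

theorem fracSymbolIntegrand_nonneg (s : ℝ) (ξ y : E) : 0 ≤ fracSymbolIntegrand s ξ y :=
  mul_nonneg (two_sub_two_mul_cos_nonneg _) (by positivity)

end Integrand

section Symbol

variable {E : Type*} [NormedAddCommGroup E] [InnerProductSpace ℝ E] [FiniteDimensional ℝ E]
  [MeasurableSpace E] [BorelSpace E]

theorem integrableOn_ball_norm_rpow_neg [Nontrivial E] {σ : ℝ} (h : σ < Module.finrank ℝ E) :
    IntegrableOn (fun y : E => ‖y‖ ^ (-σ)) (Metric.ball 0 1) := by
  obtain ⟨C, hC⟩ := exists_lintegral_ball_zero_norm_rpow_le (volume : Measure E) h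
  refine ⟨(measurable_norm.pow_const _).aestronglyMeasurable, ?_⟩
  rw [HasFiniteIntegral]
  simp_rw [Real.enorm_eq_ofReal (Real.rpow_nonneg (norm_nonneg _) _)]
  exact (hC 1 one_pos).trans_lt (ENNReal.mul_lt_top ENNReal.coe_lt_top ENNReal.ofReal_lt_top)

theorem integrableOn_compl_ball_norm_rpow_neg {σ : ℝ} (h : Module.finrank ℝ E < σ) :
    IntegrableOn (fun y : E => ‖y‖ ^ (-σ)) (Metric.ball 0 1)ᶜ := by
  obtain ⟨C, hC⟩ := exists_lintegral_compl_ball_norm_rpow_le (volume : Measure E) h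
  refine ⟨(measurable_norm.pow_const _).aestronglyMeasurable, ?_⟩
  rw [HasFiniteIntegral]
  simp_rw [Real.enorm_eq_ofReal (Real.rpow_nonneg (norm_nonneg _) _)]
  exact (hC 1 one_pos).trans_lt (ENNReal.mul_lt_top ENNReal.coe_lt_top ENNReal.ofReal_lt_top)

/-- Near the origin `2 - 2cos` is quadratic in `y`, leaving `‖y‖^(2-n-2s)`, integrable as `s < 1`;
at infinity it is bounded and `s > 0` suffices. -/
theorem integrable_fracSymbolIntegrand [Nontrivial E] {s : ℝ} (hs0 : 0 < s) (hs1 : s < 1) (ξ : E) :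
    Integrable (fracSymbolIntegrand s ξ) := by
  have hm : Measurable (fracSymbolIntegrand s ξ) := by unfold fracSymbolIntegrand; fun_prop
  have hin : IntegrableOn (fracSymbolIntegrand s ξ) (Metric.ball 0 1) := by
    refine Integrable.mono' ((integrableOn_ball_norm_rpow_neg (E := E)
      (σ := Module.finrank ℝ E + 2 * s - 2) (by linarith)).const_mul (4 * Real.pi ^ 2 * ‖ξ‖ ^ 2))
      hm.aestronglyMeasurable (ae_of_all _ fun y => ?_)
    rw [Real.norm_of_nonneg (fracSymbolIntegrand_nonneg _ _ _), fracSymbolIntegrand]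
    rcases eq_or_ne y 0 with rfl | hy
    · simp; positivity
    have hy0 : 0 < ‖y‖ := norm_pos_iff.2 hy
    have h1 := Real.one_sub_sq_div_two_le_cos (x := 2 * Real.pi * inner ℝ ξ y)
    have h2 : (inner ℝ ξ y) ^ 2 ≤ (‖ξ‖ * ‖y‖) ^ 2 := by
      rw [sq_le_sq, abs_of_nonneg (by positivity : 0 ≤ ‖ξ‖ * ‖y‖)]
      exact abs_real_inner_le_norm ξ y
    have h3 : ‖y‖ ^ (-(Module.finrank ℝ E + 2 * s - 2)) =
        ‖y‖ ^ 2 * ‖y‖ ^ (-(Module.finrank ℝ E + 2 * s)) := by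
      rw [← Real.rpow_natCast, ← Real.rpow_add hy0]
      congr 1; push_cast; ring
    rw [h3, ← mul_assoc]
    gcongr
    have h4 : 0 ≤ Real.pi ^ 2 := sq_nonneg _
    nlinarith
  have hout : IntegrableOn (fracSymbolIntegrand s ξ) (Metric.ball 0 1)ᶜ := by
    refine Integrable.mono' ((integrableOn_compl_ball_norm_rpow_neg (E := E)
      (σ := Module.finrank ℝ E + 2 * s) (by linarith)).const_mul 4)
      hm.aestronglyMeasurable (ae_of_all _ fun y => ?_)
    rw [Real.norm_of_nonneg (fracSymbolIntegrand_nonneg _ _ _), fracSymbolIntegrand]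
    gcongr
    linarith [Real.neg_one_le_cos (2 * Real.pi * inner ℝ ξ y)]
  have := hin.union hout
  rwa [Set.union_compl_self, integrableOn_univ] at this

/-- The integral is invariant under isometries in `ξ` and homogeneous of degree `2s` by scaling `y`;
a reflection carries `ξ` to `‖ξ‖ • e`. -/
theorem integral_fracSymbolIntegrand_eq {s : ℝ} {e : E} (he : ‖e‖ = 1) (hs : 0 < s) (ξ : E) :
    ∫ y, fracSymbolIntegrand s ξ y = (∫ y, fracSymbolIntegrand s e y) * ‖ξ‖ ^ (2 * s) := by
  rcases eq_or_ne ξ 0 with rfl | hξ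
  · simp [fracSymbolIntegrand, Real.zero_rpow (by linarith : 2 * s ≠ 0)]
  set r := ‖ξ‖ with hr
  have hr0 : 0 < r := norm_pos_iff.2 hξ
  have hnorm : ‖ξ‖ = ‖r • e‖ := by rw [norm_smul, he, hr, norm_norm, mul_one]
  set T := (ℝ ∙ (ξ - r • e))ᗮ.reflection
  have hT : T ξ = r • e := Submodule.reflection_sub hnorm
  have h1 : ∀ y, fracSymbolIntegrand s ξ y = fracSymbolIntegrand s (r • e) (T y) := by
    intro y
    rw [fracSymbolIntegrand, fracSymbolIntegrand, ← hT, T.inner_map_map, T.norm_map]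
  have h2 : ∀ y, fracSymbolIntegrand s (r • e) y =
      r ^ (Module.finrank ℝ E + 2 * s) * fracSymbolIntegrand s e (r • y) := by
    intro y
    have hrr : r ^ (Module.finrank ℝ E + 2 * s) * r ^ (-(Module.finrank ℝ E + 2 * s)) = 1 := by
      rw [← Real.rpow_add hr0, add_neg_cancel, Real.rpow_zero]
    simp only [fracSymbolIntegrand, inner_smul_left, inner_smul_right, norm_smul,
      Real.norm_of_nonneg hr0.le, conj_trivial]
    rw [Real.mul_rpow hr0.le (norm_nonneg _)]
    linear_combination (-((2 - 2 * Real.cos (2 * Real.pi * (r * inner ℝ e y))) *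
      ‖y‖ ^ (-(Module.finrank ℝ E + 2 * s)))) * hrr
  calc ∫ y, fracSymbolIntegrand s ξ y = ∫ y, fracSymbolIntegrand s (r • e) (T y) := by simp only [h1]
    _ = ∫ y, fracSymbolIntegrand s (r • e) y :=
        T.measurePreserving.integral_comp T.toHomeomorph.measurableEmbedding _
    _ = _ := by
        simp only [h2]
        rw [integral_const_mul, Measure.integral_comp_smul, abs_of_nonneg (by positivity),
          smul_eq_mul, Real.rpow_add hr0, Real.rpow_natCast]
        field_simp

theorem integral_fracSymbolIntegrand_pos [Nontrivial E] {s : ℝ} (hs0 : 0 < s) (hs1 : s < 1)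
    {e : E} (he : ‖e‖ = 1) : 0 < ∫ y, fracSymbolIntegrand s e y := by
  rw [integral_pos_iff_support_of_nonneg (fracSymbolIntegrand_nonneg s e)
    (integrable_fracSymbolIntegrand hs0 hs1 e)]
  have ho : IsOpen {y : E | Real.cos (2 * Real.pi * inner ℝ e y) < 1 ∧ y ≠ 0} :=
    (isOpen_lt (f := fun y : E => Real.cos (2 * Real.pi * inner ℝ e y)) (by fun_prop)
      continuous_const).inter isOpen_ne
  -- At `y = e/2` the phase is `π`, so the cosine is `-1`.
  refine (ho.measure_pos volume ⟨(1 / 2 : ℝ) • e, ?_, ?_⟩).trans_le (measure_mono ?_)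
  · rw [inner_smul_right, real_inner_self_eq_norm_sq, he]
    rw [show 2 * Real.pi * (1 / 2 * 1 ^ 2) = Real.pi by ring, Real.cos_pi]
    norm_num
  · have : e ≠ 0 := by rintro rfl; simp at he
    simpa using this
  · rintro y ⟨hy1, hy2⟩
    have hy0 : 0 < ‖y‖ := norm_pos_iff.2 hy2
    exact (mul_pos (by linarith) (Real.rpow_pos_of_pos hy0 _)).ne'

theorem integrable_norm_rpow_mul_schwartz {s : ℝ} (hs0 : 0 < s) (hs1 : s < 1) (v : 𝓢(E, ℂ)) :
    Integrable fun ξ => ((‖ξ‖ ^ (2 * s) : ℝ) : ℂ) * v ξ := by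
  have h1 := (v.integrable_pow_mul volume 0).add (v.integrable_pow_mul volume 2)
  have hv := v.continuous
  refine Integrable.mono' h1 ?_ (ae_of_all _ fun ξ => ?_)
  · have : Continuous fun ξ : E => ‖ξ‖ ^ (2 * s) :=
      continuous_norm.rpow_const fun _ => Or.inr (by linarith)
    exact (by fun_prop : Continuous _).aestronglyMeasurable
  · rw [norm_mul, Complex.norm_real, Real.norm_of_nonneg (by positivity), Pi.add_apply, ← add_mul]
    gcongr
    rw [pow_zero]
    rcases le_total ‖ξ‖ 1 with h | h
    · exact (Real.rpow_le_one (norm_nonneg _) h (by linarith)).trans (by nlinarith [sq_nonneg ‖ξ‖])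
    · have := Real.rpow_le_rpow_of_exponent_le h
        (by push_cast; linarith : 2 * s ≤ (2 : ℕ))
      rw [Real.rpow_natCast] at this
      linarith

/-- The integral of weighted second differences is a Fourier multiplier with symbol a multiple of
`‖ξ‖ ^ (2 * s)`. -/
theorem integral_second_difference_fourier [Nontrivial E] {s : ℝ} (hs0 : 0 < s) (hs1 : s < 1)
    {e : E} (he : ‖e‖ = 1) (v : 𝓢(E, ℂ)) (x : E) :
    ∫ y, (2 * FourierTransform.fourier (v : E → ℂ) x - FourierTransform.fourier (v : E → ℂ) (x + y) -
        FourierTransform.fourier (v : E → ℂ) (x - y)) *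
        ((‖y‖ ^ (-(Module.finrank ℝ E + 2 * s : ℝ)) : ℝ) : ℂ) =
      ((∫ y, fracSymbolIntegrand s e y : ℝ) : ℂ) *
        FourierTransform.fourier (fun ξ : E => ((‖ξ‖ ^ (2 * s) : ℝ) : ℂ) * v ξ) x := by
  have hv := v.continuous
  have hvi : Integrable (v : E → ℂ) := v.integrable
  set ch : E → E → ℂ := fun ξ z => Complex.exp (((-2 * Real.pi * inner ℝ ξ z : ℝ) : ℂ) * Complex.I)
    with hch
  have hchn : ∀ ξ z, ‖ch ξ z‖ = 1 := fun ξ z => Complex.norm_exp_ofReal_mul_I _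
  have hchc : Continuous fun p : E × E => ch p.1 p.2 := by rw [hch]; fun_prop
  have hchi : ∀ z, Integrable fun ξ => ch ξ z * v ξ := by
    intro z
    refine hvi.norm.mono' ?_ (ae_of_all _ fun ξ => by rw [norm_mul, hchn, one_mul])
    have : Continuous fun ξ => ch ξ z := by rw [hch]; fun_prop
    exact (this.mul hv).aestronglyMeasurable
  have hF : ∀ (g : E → ℂ) z, FourierTransform.fourier g z = ∫ ξ, ch ξ z * g ξ := by
    intro g z
    rw [Real.fourier_eq']
    rfl
  have hdiff : ∀ y ξ, 2 * ch ξ x - ch ξ (x + y) - ch ξ (x - y) =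
      ((2 - 2 * Real.cos (2 * Real.pi * inner ℝ ξ y) : ℝ) : ℂ) * ch ξ x := by
    intro y ξ
    have e1 : ch ξ (x + y) = ch ξ x * Complex.exp (-((2 * Real.pi * inner ℝ ξ y : ℝ) * Complex.I)) := by
      rw [hch]; dsimp only; rw [← Complex.exp_add, inner_add_right]; congr 1; push_cast; ring
    have e2 : ch ξ (x - y) = ch ξ x * Complex.exp ((2 * Real.pi * inner ℝ ξ y : ℝ) * Complex.I) := by
      rw [hch]; dsimp only; rw [← Complex.exp_add, inner_sub_right]; congr 1; push_cast; ring
    rw [e1, e2, ← neg_mul]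
    push_cast [Complex.cos]
    ring
  have hstep : ∀ y, (2 * FourierTransform.fourier (v : E → ℂ) x -
        FourierTransform.fourier (v : E → ℂ) (x + y) - FourierTransform.fourier (v : E → ℂ) (x - y)) *
        ((‖y‖ ^ (-(Module.finrank ℝ E + 2 * s : ℝ)) : ℝ) : ℂ) =
      ∫ ξ, (fracSymbolIntegrand s ξ y : ℂ) * (ch ξ x * v ξ) := by
    intro y
    simp only [hF]
    have hi1 : Integrable fun ξ => 2 * (ch ξ x * v ξ) := (hchi x).const_mul 2
    have hi2 : Integrable fun ξ => 2 * (ch ξ x * v ξ) - ch ξ (x + y) * v ξ := hi1.sub (hchi _)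
    rw [← integral_const_mul, ← integral_sub hi1 (hchi _), ← integral_sub hi2 (hchi _),
      ← integral_mul_const]
    refine integral_congr_ae (ae_of_all _ fun ξ => ?_)
    dsimp only
    have := hdiff y ξ
    rw [fracSymbolIntegrand]
    push_cast at this ⊢
    linear_combination (v ξ * ((‖y‖ ^ (-(Module.finrank ℝ E + 2 * s : ℝ)) : ℝ) : ℂ)) * this
  simp only [hstep]
  rw [integral_integral_swap]
  · rw [hF, ← integral_const_mul]
    refine integral_congr_ae (ae_of_all _ fun ξ => ?_)
    dsimp only
    rw [integral_mul_const, integral_complex_ofReal, integral_fracSymbolIntegrand_eq he hs0 ξ]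
    push_cast
    ring
  · have hmeas : AEStronglyMeasurable (Function.uncurry fun y ξ : E =>
        (fracSymbolIntegrand s ξ y : ℂ) * (ch ξ x * v ξ)) (volume.prod volume) := by
      have h1 : Measurable fun p : E × E => fracSymbolIntegrand s p.2 p.1 := by
        unfold fracSymbolIntegrand; fun_prop
      have h2 : Continuous fun p : E × E => ch p.2 x * v p.2 :=
        (hchc.comp (continuous_snd.prodMk continuous_const)).mul (hv.comp continuous_snd)
      exact ((Complex.measurable_ofReal.comp h1).mul h2.measurable).aestronglyMeasurable
    rw [integrable_prod_iff' hmeas]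
    refine ⟨ae_of_all _ fun ξ => ?_, ?_⟩
    · have h : Integrable fun y => (fracSymbolIntegrand s ξ y : ℂ) :=
        (integrable_fracSymbolIntegrand hs0 hs1 ξ).ofReal
      exact h.mul_const (ch ξ x * v ξ)
    -- Fubini is justified because integrating the modulus in `y` gives the symbol, a multiple of
    -- `‖ξ‖^(2s)`, times `‖v ξ‖`.
    · refine (((integrable_norm_rpow_mul_schwartz hs0 hs1 v).norm).const_mul
        (∫ y, fracSymbolIntegrand s e y)).congr (ae_of_all _ fun ξ => ?_)
      simp only [Function.uncurry, norm_mul, hchn, one_mul, Complex.norm_real,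
        Real.norm_of_nonneg (fracSymbolIntegrand_nonneg _ _ _)]
      rw [integral_mul_const, integral_fracSymbolIntegrand_eq he hs0 ξ,
        Real.norm_of_nonneg (by positivity)]
      ring

end Symbol

/-! ### Gaussian subordination and the Riesz kernel -/

theorem exp_neg_div_le_rpow {a τ m : ℝ} (ha : 0 < a) (hτ : 0 < τ) (hm : 0 < m) :
    Real.exp (-(a / τ)) ≤ m ^ m * (τ / a) ^ m := by
  have h1 : a / τ / m ≤ Real.exp (a / τ / m) := by linarith [Real.add_one_le_exp (a / τ / m)]
  have h2 := Real.rpow_le_rpow (by positivity) h1 hm.le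
  rw [← Real.exp_mul, div_mul_cancel₀ _ hm.ne', Real.div_rpow (by positivity) hm.le,
    div_le_iff₀ (by positivity)] at h2
  rw [Real.exp_neg, ← inv_div a τ, Real.inv_rpow (by positivity),
    ← div_eq_mul_inv, inv_le_comm₀ (Real.exp_pos _) (by positivity), inv_div,
    div_le_iff₀ (by positivity)]
  exact h2

theorem exists_lintegral_rpow_mul_exp_neg_div_le {θ : ℝ} (hθ : 0 < θ) :
    ∃ K : ℝ≥0, ∀ a : ℝ, 0 < a →
      ∫⁻ τ in Set.Ioi (0 : ℝ), ENNReal.ofReal (τ ^ (-θ - 1) * Real.exp (-(a / τ))) ≤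
        K * ENNReal.ofReal (a ^ (-θ)) := by
  -- With this `m`, the bound `m^m (τ/a)^m` for the exponential cancels `τ^(-θ-1)` exactly on
  -- `(0,a]`; beyond `a` the exponential is bounded by 1.
  set m := θ + 1 with hm
  have hm0 : 0 < m := by positivity
  refine ⟨((m ^ m).toNNReal + (1 / θ).toNNReal), fun a ha => ?_⟩
  rw [← Set.Ioc_union_Ioi_eq_Ioi ha.le]
  refine (lintegral_union_le _ _ _).trans ?_
  rw [ENNReal.coe_add, add_mul]
  gcongr
  · calc _ ≤ ∫⁻ _ in Set.Ioc 0 a, ENNReal.ofReal (m ^ m * a ^ (-m)) := by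
          refine setLIntegral_mono' measurableSet_Ioc fun τ hτ => ENNReal.ofReal_le_ofReal ?_
          have hτ0 : 0 < τ := hτ.1
          calc _ ≤ τ ^ (-θ - 1) * (m ^ m * (τ / a) ^ m) := by
                gcongr
                exact exp_neg_div_le_rpow ha hτ0 hm0
            _ = _ := by
                rw [Real.div_rpow hτ0.le ha.le, show -θ - 1 = -m by rw [hm]; ring,
                  Real.rpow_neg hτ0.le, Real.rpow_neg ha.le]
                field_simp
      _ = _ := by
          rw [setLIntegral_const, Real.volume_Ioc, sub_zero,
            ENNReal.ofReal_mul (by positivity), mul_assoc, ← ENNReal.ofReal_mul (by positivity)]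
          rw [show a ^ (-m) * a = a ^ (-θ) by
            rw [← Real.rpow_add_one ha.ne', hm]; congr 1; ring]
          rfl
  · calc _ ≤ ∫⁻ τ in Set.Ioi a, ENNReal.ofReal (τ ^ (-θ - 1)) := by
          refine setLIntegral_mono' measurableSet_Ioi fun τ hτ => ENNReal.ofReal_le_ofReal ?_
          have hτ0 : 0 < τ := ha.trans hτ
          refine mul_le_of_le_one_right (by positivity) (Real.exp_le_one_iff.2 ?_)
          rw [neg_nonpos]; positivity
      _ = _ := by
          rw [lintegral_Ioi_rpow_le ha (by linarith), show -θ - 1 + 1 = -θ by ring, neg_neg,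
            div_eq_mul_one_div, mul_comm, ENNReal.ofReal_mul (by positivity)]
          rfl

theorem integrableOn_rpow_mul_exp_neg_mul {s r : ℝ} (hs : 0 < s) (hr : 0 < r) :
    IntegrableOn (fun τ : ℝ => τ ^ (s - 1) * Real.exp (-(r * τ))) (Set.Ioi 0) := by
  -- The Bochner integral of a nonintegrable function is 0 by convention, so a nonzero Gamma value
  -- proves integrability.
  refine Integrable.of_integral_ne_zero ?_
  rw [Real.integral_rpow_mul_exp_neg_mul_Ioi hs hr]
  have := Real.Gamma_pos_of_pos hs
  positivity

theorem integral_rpow_mul_exp_neg_mul_norm_sq {E : Type*} [NormedAddCommGroup E]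
    {s : ℝ} (hs : 0 < s) {ξ : E} (hξ : ξ ≠ 0) :
    (∫ τ in Set.Ioi (0 : ℝ), τ ^ (s - 1) * Real.exp (-(Real.pi ^ 2 * ‖ξ‖ ^ 2 * τ))) *
      ‖ξ‖ ^ (2 * s) = Real.Gamma s * Real.pi ^ (-(2 * s)) := by
  have hξ0 : 0 < ‖ξ‖ := norm_pos_iff.2 hξ
  rw [Real.integral_rpow_mul_exp_neg_mul_Ioi hs (by positivity), one_div,
    Real.inv_rpow (by positivity), ← mul_pow, ← Real.rpow_natCast, ← Real.rpow_mul (by positivity),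
    Real.mul_rpow Real.pi_pos.le hξ0.le, Real.rpow_neg Real.pi_pos.le]
  push_cast
  field_simp

section Fourier

variable {E : Type*} [NormedAddCommGroup E] [InnerProductSpace ℝ E] [FiniteDimensional ℝ E]
  [MeasurableSpace E] [BorelSpace E]

theorem integral_fourier_mul_eq_of_integrable {f g : E → ℂ} (hf : Integrable f)
    (hg : Integrable g) :
    ∫ ξ, FourierTransform.fourier f ξ * g ξ = ∫ x, f x * FourierTransform.fourier g x := by
  have h := VectorFourier.integral_fourierIntegral_smul_eq_flip (L := innerₗ E)
    Real.continuous_fourierChar continuous_inner hf hg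
  rw [flip_innerₗ] at h
  exact h

theorem integrable_real_gaussian {b : ℝ} (hb : 0 < b) :
    Integrable fun z : E => ((Real.exp (-b * ‖z‖ ^ 2) : ℝ) : ℂ) := by
  have := GaussianFourier.integrable_cexp_neg_mul_sq_norm_add (V := E) (b := (b : ℂ))
    (by simpa using hb) 0 0
  refine this.congr (ae_of_all _ fun z => ?_)
  push_cast
  simp

theorem fourier_real_gaussian {b : ℝ} (hb : 0 < b) (ξ : E) :
    FourierTransform.fourier (fun z : E => ((Real.exp (-b * ‖z‖ ^ 2) : ℝ) : ℂ)) ξ =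
      (((Real.pi / b) ^ (Module.finrank ℝ E / 2 : ℝ) *
        Real.exp (-Real.pi ^ 2 * ‖ξ‖ ^ 2 / b) : ℝ) : ℂ) := by
  have h := fourier_gaussian_innerProductSpace (V := E) (b := (b : ℂ)) (by simpa using hb) ξ
  push_cast
  rw [Complex.ofReal_cpow (by positivity)]
  push_cast
  exact h

/-- The multiplication formula applied to `exp(-‖z‖²/τ)`, whose transform is `(πτ)^(n/2)
exp(-π²‖ξ‖²τ)`. -/
theorem integral_gaussian_mul_fourier {k : E → ℂ} (hk : Integrable k) {τ : ℝ} (hτ : 0 < τ) :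
    ∫ ξ, ((Real.exp (-(Real.pi ^ 2 * ‖ξ‖ ^ 2 * τ)) : ℝ) : ℂ) * k ξ =
      (((Real.pi * τ) ^ (-(Module.finrank ℝ E / 2 : ℝ)) : ℝ) : ℂ) *
        ∫ z, ((Real.exp (-(‖z‖ ^ 2 / τ)) : ℝ) : ℂ) * FourierTransform.fourier k z := by
  have hb : 0 < 1 / τ := by positivity
  have h := integral_fourier_mul_eq_of_integrable (integrable_real_gaussian (E := E) hb) hk
  simp only [fourier_real_gaussian hb] at h
  have e1 : ∀ z : E, -(1 / τ) * ‖z‖ ^ 2 = -(‖z‖ ^ 2 / τ) := fun z => by ring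
  have e2 : ∀ z : E, -Real.pi ^ 2 * ‖z‖ ^ 2 / (1 / τ) = -(Real.pi ^ 2 * ‖z‖ ^ 2 * τ) :=
    fun z => by field_simp
  have e3 : Real.pi / (1 / τ) = Real.pi * τ := by field_simp
  simp only [e1, e2, e3] at h
  rw [← h, ← integral_const_mul]
  refine integral_congr_ae (ae_of_all _ fun ξ => ?_)
  dsimp only
  rw [← mul_assoc, ← Complex.ofReal_mul, ← mul_assoc, ← Real.rpow_add (by positivity),
    neg_add_cancel, Real.rpow_zero, one_mul]

/-- Subordination: the negative power `‖ξ‖ ^ (-2 * s)` as a superposition of Gaussians. -/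
theorem integral_rpow_mul_integral_gaussian {s : ℝ} (hs : 0 < s) [Nontrivial E] {q : E → ℂ}
    (hq : Integrable q) (hqc : Continuous q) :
    ∫ τ in Set.Ioi (0 : ℝ), ((τ ^ (s - 1) : ℝ) : ℂ) *
        ∫ ξ, ((Real.exp (-(Real.pi ^ 2 * ‖ξ‖ ^ 2 * τ)) : ℝ) : ℂ) *
          (((‖ξ‖ ^ (2 * s) : ℝ) : ℂ) * q ξ) =
      ((Real.Gamma s * Real.pi ^ (-(2 * s)) : ℝ) : ℂ) * ∫ ξ, q ξ := by
  have h0 : ∀ᵐ ξ : E, ξ ≠ 0 := by simp [ae_iff, measure_singleton]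
  set G : ℝ → E → ℂ := fun τ ξ =>
    ((τ ^ (s - 1) * Real.exp (-(Real.pi ^ 2 * ‖ξ‖ ^ 2 * τ)) : ℝ) : ℂ) *
      (((‖ξ‖ ^ (2 * s) : ℝ) : ℂ) * q ξ) with hG
  have hmeas : AEStronglyMeasurable (Function.uncurry G)
      ((volume.restrict (Set.Ioi (0 : ℝ))).prod volume) := by
    have hqm := hqc.measurable
    have h1 : Measurable fun p : ℝ × E =>
        p.1 ^ (s - 1) * Real.exp (-(Real.pi ^ 2 * ‖p.2‖ ^ 2 * p.1)) :=
      (measurable_fst.pow_const _).mul (by fun_prop)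
    have h2 : Measurable fun p : ℝ × E => ‖p.2‖ ^ (2 * s) :=
      (measurable_norm.comp measurable_snd).pow_const _
    exact ((Complex.measurable_ofReal.comp h1).mul ((Complex.measurable_ofReal.comp h2).mul
      (hqm.comp measurable_snd))).aestronglyMeasurable
  have hint : Integrable (Function.uncurry G) ((volume.restrict (Set.Ioi (0 : ℝ))).prod volume) := by
    rw [integrable_prod_iff' hmeas]
    refine ⟨?_, ?_⟩
    · filter_upwards [h0] with ξ hξ
      have hξ0 : 0 < ‖ξ‖ := norm_pos_iff.2 hξ
      have h := (integrableOn_rpow_mul_exp_neg_mul hs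
        (by positivity : 0 < Real.pi ^ 2 * ‖ξ‖ ^ 2)).ofReal (𝕜 := ℂ)
      exact h.mul_const (((‖ξ‖ ^ (2 * s) : ℝ) : ℂ) * q ξ)
    · refine (hq.norm.const_mul (Real.Gamma s * Real.pi ^ (-(2 * s)))).congr ?_
      filter_upwards [h0] with ξ hξ
      rw [← integral_rpow_mul_exp_neg_mul_norm_sq hs hξ, mul_assoc, ← integral_mul_const]
      refine setIntegral_congr_fun measurableSet_Ioi fun τ hτ => ?_
      have hτ : 0 < τ := hτ
      simp only [Function.uncurry, hG, norm_mul, Complex.norm_real]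
      rw [Real.norm_of_nonneg (by positivity), Real.norm_of_nonneg (by positivity),
        Real.norm_of_nonneg (by positivity)]
  calc _ = ∫ τ in Set.Ioi (0 : ℝ), ∫ ξ, G τ ξ := by
        congr 1; ext τ
        rw [← integral_const_mul]
        congr 1; ext ξ
        rw [hG]; push_cast; ring
    _ = ∫ ξ, ∫ τ in Set.Ioi (0 : ℝ), G τ ξ := integral_integral_swap hint
    _ = _ := by
        rw [← integral_const_mul]
        refine integral_congr_ae ?_
        filter_upwards [h0] with ξ hξ
        rw [hG]
        dsimp only
        rw [integral_mul_const, integral_complex_ofReal,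
          ← integral_rpow_mul_exp_neg_mul_norm_sq hs hξ]
        push_cast
        ring

/-- `𝓕 v` is bounded by the Riesz potential of order `2 * s` of `𝓕 (‖ξ‖ ^ (2 * s) * v)`. -/
theorem exists_enorm_fourier_le_rieszPotential [Nontrivial E] {s : ℝ} (hs0 : 0 < s) (hs1 : s < 1)
    (hs : 2 * s < Module.finrank ℝ E) :
    ∃ K : ℝ≥0, ∀ (v : 𝓢(E, ℂ)) (x : E), ‖FourierTransform.fourier (v : E → ℂ) x‖ₑ ≤
      K * ∫⁻ y, ENNReal.ofReal (‖x - y‖ ^ (2 * s - Module.finrank ℝ E)) *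
        ‖FourierTransform.fourier (fun ξ : E => ((‖ξ‖ ^ (2 * s) : ℝ) : ℂ) * v ξ) y‖ₑ := by
  set n : ℝ := (Module.finrank ℝ E : ℝ) with hn
  -- The weight `τ^(s-1)` and the Gaussian factor `τ^(-n/2)` combine to `τ^(-θ-1)`; with `a = ‖z‖²`
  -- the result `a^(-θ)` is `‖z‖^(2s-n)`.
  obtain ⟨K, hK⟩ := exists_lintegral_rpow_mul_exp_neg_div_le (θ := n / 2 - s) (by linarith)
  set c : ℝ := Real.Gamma s * Real.pi ^ (-(2 * s)) with hc
  have hc0 : 0 < c := mul_pos (Real.Gamma_pos_of_pos hs0) (Real.rpow_pos_of_pos Real.pi_pos _)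
  have hc1 : ‖c‖₊ ≠ 0 := by simpa using hc0.ne'
  refine ⟨‖c‖₊⁻¹ * ((Real.pi ^ (-(n / 2))).toNNReal * K), fun v x => ?_⟩
  set F := FourierTransform.fourier (fun ξ : E => ((‖ξ‖ ^ (2 * s) : ℝ) : ℂ) * v ξ) with hF
  have hhi := integrable_norm_rpow_mul_schwartz hs0 hs1 v
  have hFc : Continuous F := VectorFourier.fourierIntegral_continuous Real.continuous_fourierChar
    continuous_inner hhi
  have hv := v.continuous
  -- Multiplying by the character at `x` moves the evaluation point: `∫ q` is the transform of `v`
  -- at `x`, and the transform of `‖ξ‖^(2s) q` at `z` is `F (x + z)`.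
  set ch : E → ℂ := fun ξ => Complex.exp (((-2 * Real.pi * inner ℝ ξ x : ℝ) : ℂ) * Complex.I)
    with hch
  have hchc : Continuous ch := by rw [hch]; fun_prop
  have hchn : ∀ ξ, ‖ch ξ‖ = 1 := fun ξ => Complex.norm_exp_ofReal_mul_I _
  set q : E → ℂ := fun ξ => ch ξ * v ξ with hq
  have hqc : Continuous q := hchc.mul hv
  have hqi : Integrable q := v.integrable.norm.mono' hqc.aestronglyMeasurable
    (ae_of_all _ fun ξ => by rw [hq]; simp [hchn])
  have hki : Integrable fun ξ : E => ((‖ξ‖ ^ (2 * s) : ℝ) : ℂ) * q ξ := by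
    refine hhi.norm.mono' ?_ (ae_of_all _ fun ξ => by rw [hq]; simp [hchn])
    exact ((Complex.measurable_ofReal.comp (measurable_norm.pow_const _)).mul
      hqc.measurable).aestronglyMeasurable
  have hFq : ∫ ξ, q ξ = FourierTransform.fourier (v : E → ℂ) x := by
    rw [Real.fourier_eq']; rfl
  have hFk : ∀ z, FourierTransform.fourier (fun ξ : E => ((‖ξ‖ ^ (2 * s) : ℝ) : ℂ) * q ξ) z =
      F (x + z) := by
    intro z
    rw [hF, Real.fourier_eq', Real.fourier_eq']
    congr 1; ext ξ
    rw [hq, hch]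
    simp only [smul_eq_mul, inner_add_right]
    rw [mul_left_comm (((‖ξ‖ ^ (2 * s) : ℝ) : ℂ)), ← mul_assoc, ← Complex.exp_add]
    congr 2
    push_cast; ring
  have hmain := integral_rpow_mul_integral_gaussian hs0 hqi hqc
  rw [hFq, setIntegral_congr_fun measurableSet_Ioi (fun τ (hτ : 0 < τ) => by
    rw [integral_gaussian_mul_fourier hki hτ])] at hmain
  simp only [hFk] at hmain
  have hup : ‖c‖ₑ * ‖FourierTransform.fourier (v : E → ℂ) x‖ₑ ≤
      (Real.pi ^ (-(n / 2))).toNNReal * K *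
        ∫⁻ y, ENNReal.ofReal (‖x - y‖ ^ (2 * s - n)) * ‖F y‖ₑ := by
    have hce : ‖c‖ₑ = ‖(c : ℂ)‖ₑ := by simp [enorm_eq_nnnorm]
    rw [hce, ← enorm_mul, ← hmain]
    refine (enorm_integral_le_lintegral_enorm _).trans ?_
    calc _ ≤ ∫⁻ τ in Set.Ioi (0 : ℝ), ∫⁻ z, ENNReal.ofReal (Real.pi ^ (-(n / 2))) *
          (ENNReal.ofReal (τ ^ (-(n / 2 - s) - 1) * Real.exp (-(‖z‖ ^ 2 / τ))) * ‖F (x + z)‖ₑ) := by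
          refine setLIntegral_mono' measurableSet_Ioi fun τ hτ => ?_
          have hτ : 0 < τ := hτ
          rw [← mul_assoc, enorm_mul]
          refine (mul_le_mul_right (enorm_integral_le_lintegral_enorm _) _).trans ?_
          rw [← lintegral_const_mul' _ _ enorm_ne_top]
          refine lintegral_mono fun z => ?_
          rw [← enorm_mul, ← mul_assoc (_ * _ : ℂ), enorm_mul, ← mul_assoc (ENNReal.ofReal _)]
          gcongr ?_ * _
          rw [← Complex.ofReal_mul, ← ENNReal.ofReal_mul (by positivity),
            ← Complex.ofReal_mul, ← ofReal_norm, Complex.norm_real,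
            Real.norm_of_nonneg (by positivity)]
          refine ENNReal.ofReal_le_ofReal (le_of_eq ?_)
          rw [Real.mul_rpow Real.pi_pos.le hτ.le,
            show -(n / 2 - s) - 1 = (s - 1) + -(n / 2) by ring, Real.rpow_add hτ]
          ring
      _ = ∫⁻ z, ENNReal.ofReal (Real.pi ^ (-(n / 2))) * ((∫⁻ τ in Set.Ioi (0 : ℝ),
          ENNReal.ofReal (τ ^ (-(n / 2 - s) - 1) * Real.exp (-(‖z‖ ^ 2 / τ)))) * ‖F (x + z)‖ₑ) := by
          have hm : Measurable fun p : ℝ × E =>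
              ENNReal.ofReal (p.1 ^ (-(n / 2 - s) - 1) * Real.exp (-(‖p.2‖ ^ 2 / p.1))) :=
            ENNReal.measurable_ofReal.comp ((measurable_fst.pow_const _).mul (by fun_prop))
          have hFm : Measurable fun z => ‖F (x + z)‖ₑ :=
            (hFc.comp (continuous_const.add continuous_id)).measurable.enorm
          rw [lintegral_lintegral_swap]
          · refine lintegral_congr fun z => ?_
            rw [lintegral_const_mul' _ _ (by simp), lintegral_mul_const]
            exact hm.comp (measurable_id.prodMk measurable_const)
          · exact (measurable_const.mul (hm.mul (hFm.comp measurable_snd))).aemeasurable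
      _ ≤ ∫⁻ z, ENNReal.ofReal (Real.pi ^ (-(n / 2))) *
          ((K * ENNReal.ofReal (‖z‖ ^ (2 * s - n))) * ‖F (x + z)‖ₑ) := by
          refine lintegral_mono_ae ?_
          have h0 : ∀ᵐ z : E, z ≠ 0 := by simp [ae_iff, measure_singleton]
          filter_upwards [h0] with z hz
          have hz0 : 0 < ‖z‖ := norm_pos_iff.2 hz
          gcongr
          refine (hK (‖z‖ ^ 2) (by positivity)).trans_eq ?_
          rw [← Real.rpow_natCast, ← Real.rpow_mul hz0.le]
          congr 3
          push_cast; ring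
      _ = _ := by
          simp only [mul_assoc]
          rw [lintegral_const_mul' _ _ (by simp), lintegral_const_mul' _ _ (by simp)]
          rw [← lintegral_add_left_eq_self
            (fun z => ENNReal.ofReal (‖x - z‖ ^ (2 * s - n)) * ‖F z‖ₑ) x]
          simp only [sub_add_cancel_left, norm_neg]
          rfl
  rw [ENNReal.coe_mul, ENNReal.coe_mul, ENNReal.coe_inv hc1, mul_assoc, mul_comm,
    ← div_eq_mul_inv, ENNReal.le_div_iff_mul_le (by simp [hc1]) (by simp), mul_comm]
  exact hup

end Fourier

/-! ### Fractional potential bound and Rellich inequalities -/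

theorem fracLaplacianConst_pos {N : ℕ} {s : ℝ} (hs0 : 0 < s) (hs1 : s < 1) :
    0 < fracLaplacianConst N s := by
  have h1 : 0 < Real.Gamma ((N : ℝ) / 2 + s) := Real.Gamma_pos_of_pos (by positivity)
  have h2 : 0 < Real.Gamma (1 - s) := Real.Gamma_pos_of_pos (by linarith)
  unfold fracLaplacianConst
  positivity

/-- A Schwartz function is bounded by the Riesz potential of its fractional Laplacian. -/
theorem exists_enorm_le_rieszPotential_fracLaplacian {N : ℕ} {s : ℝ} (hs0 : 0 < s) (hs1 : s < 1)
    (hs : 2 * s < N) :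
    ∃ K : ℝ≥0, ∀ u : 𝓢(EuclideanSpace ℝ (Fin N), ℝ), Measurable (fracLaplacian s u) ∧
      ∀ x, ‖u x‖ₑ ≤ K * ∫⁻ y, ENNReal.ofReal (‖x - y‖ ^ (2 * s - N)) * ‖fracLaplacian s u y‖ₑ := by
  have hN : 0 < N := by
    have : (0 : ℝ) < N := by linarith
    exact_mod_cast this
  have : Nontrivial (EuclideanSpace ℝ (Fin N)) :=
    Module.nontrivial_of_finrank_pos (R := ℝ) (by simpa using hN)
  obtain ⟨K, hK⟩ := exists_enorm_fourier_le_rieszPotential (E := EuclideanSpace ℝ (Fin N)) hs0 hs1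
    (by simpa using hs)
  obtain ⟨e, he⟩ := exists_norm_eq (EuclideanSpace ℝ (Fin N)) zero_le_one
  set κ := ∫ y, fracSymbolIntegrand s e y with hκ
  have hκ0 : 0 < κ := integral_fracSymbolIntegrand_pos hs0 hs1 he
  set c := fracLaplacianConst N s / 2 * κ with hc
  have hc0 : 0 < c := mul_pos (half_pos (fracLaplacianConst_pos hs0 hs1)) hκ0
  have hc1 : ‖c‖₊ ≠ 0 := by simpa using hc0.ne'
  refine ⟨‖c‖₊⁻¹ * K, fun u => ?_⟩
  set U : 𝓢(EuclideanSpace ℝ (Fin N), ℂ) := u.postcompCLM Complex.ofRealCLM with hU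
  -- Writing `u` as the transform of a Schwartz function makes its fractional Laplacian a constant
  -- multiple of `F`, which is continuous; measurability follows as well.
  set v : 𝓢(EuclideanSpace ℝ (Fin N), ℂ) := FourierTransformInv.fourierInv U with hv
  have hvU : ∀ x, FourierTransform.fourier (v : EuclideanSpace ℝ (Fin N) → ℂ) x = u x := by
    intro x
    rw [← SchwartzMap.fourier_coe, hv, FourierTransform.fourier_fourierInv_eq]
    rfl
  set F := FourierTransform.fourier
    (fun ξ : EuclideanSpace ℝ (Fin N) => ((‖ξ‖ ^ (2 * s) : ℝ) : ℂ) * v ξ) with hF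
  have hFc : Continuous F := VectorFourier.fourierIntegral_continuous Real.continuous_fourierChar
    continuous_inner (integrable_norm_rpow_mul_schwartz hs0 hs1 v)
  have hfrac : ∀ x, ((fracLaplacian s u x : ℝ) : ℂ) = c * F x := by
    intro x
    have h := integral_second_difference_fourier hs0 hs1 he v x
    simp only [hvU, finrank_euclideanSpace_fin] at h
    rw [fracLaplacian, hc, Complex.ofReal_mul, Complex.ofReal_mul, mul_assoc, ← h,
      ← integral_complex_ofReal]
    congr 2
    ext y
    rw [div_eq_mul_inv, ← Real.rpow_neg (norm_nonneg _)]
    push_cast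
    rfl
  have hfm : Measurable (fracLaplacian s u) := by
    have : fracLaplacian s u = fun x => (c * F x).re := by
      ext x
      rw [← hfrac, Complex.ofReal_re]
    rw [this]
    exact (Complex.continuous_re.comp (continuous_const.mul hFc)).measurable
  refine ⟨hfm, fun x => ?_⟩
  have hFe : ∀ y, ‖F y‖ₑ = (‖c‖₊⁻¹ : ℝ≥0) * ‖fracLaplacian s u y‖ₑ := by
    intro y
    have h1 : ‖fracLaplacian s u y‖ₑ = ‖c‖₊ * ‖F y‖ₑ := by
      have : ‖fracLaplacian s u y‖ₑ = ‖((fracLaplacian s u y : ℝ) : ℂ)‖ₑ := by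
        simp [enorm_eq_nnnorm]
      rw [this, hfrac, enorm_mul]
      simp [enorm_eq_nnnorm]
    rw [h1, ← mul_assoc, ← ENNReal.coe_mul, inv_mul_cancel₀ hc1, ENNReal.coe_one, one_mul]
  have h := hK v x
  rw [hvU] at h
  simp only [← hF, hFe, finrank_euclideanSpace_fin] at h
  have hue : ‖((u x : ℝ) : ℂ)‖ₑ = ‖u x‖ₑ := by simp [enorm_eq_nnnorm]
  rw [hue] at h
  refine h.trans_eq ?_
  simp only [mul_left_comm _ ((‖c‖₊⁻¹ : ℝ≥0) : ℝ≥0∞)]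
  rw [lintegral_const_mul' _ _ (by simp), ENNReal.coe_mul]
  ring

/-- Weighted Rellich inequality in Morrey spaces. -/
theorem exists_morreyNorm_rellich_le {N : ℕ} {p α β lam : ℝ} (hp : 1 < p) (hαβ : α + β = 2)
    (hα : α < N / p.conjExponent) (hβ : β < (N - lam) / p) (hlam : 0 < lam) (hlam' : lam ≤ N) :
    ∃ C : ℝ≥0, 0 < C ∧ ∀ u : EuclideanSpace ℝ (Fin N) → ℝ, ContDiff ℝ 2 u → VanishesInMean u →
      morreyNorm p lam (fun x => u x / ‖x‖ ^ β) ≤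
        C * morreyNorm p lam (fun x => ‖x‖ ^ α * Δ u x) := by
  have hp0 : 0 < p := by linarith
  -- Adding the two weight conditions gives `2 = α + β < N - lam/p < N`, as the Newtonian bound
  -- requires.
  have hN : 2 < N := by
    have h1 : (N : ℝ) / p.conjExponent + (N - lam) / p = N - lam / p := by
      rw [Real.conjExponent]
      field_simp
      ring
    have h2 : 0 < lam / p := by positivity
    have h3 : (2 : ℝ) < N := by linarith
    exact_mod_cast h3
  obtain ⟨K, hK⟩ := exists_enorm_le_newtonPotential_laplacian (E := EuclideanSpace ℝ (Fin N))
    (by simpa using hN)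
  simp only [finrank_euclideanSpace_fin] at hK
  obtain ⟨C, hC0, hC⟩ := exists_morreyNorm_le_of_le_rieszPotential (by lia) hp hα hlam hlam' hβ hαβ
    two_pos K
  refine ⟨C, hC0, fun u hu hv => ?_⟩
  have h := hC u (Δ u) (continuous_laplacian hu).measurable (hK u hu hv)
  have he : (fun x => u x / ‖x‖ ^ β) = fun x => ‖x‖ ^ (-β) * u x := by
    ext x
    rw [Real.rpow_neg (norm_nonneg _), div_eq_inv_mul]
  rwa [he]

/-- Weighted fractional Rellich inequality in Morrey spaces. -/
theorem exists_morreyNorm_fractional_rellich_le {N : ℕ} {p α β γ lam : ℝ} (hp : 1 < p)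
    (hα : α < N / p.conjExponent) (hβ : β < (N - lam) / p) (hαβ : α + β = γ) (hγ0 : 0 < γ)
    (hγ2 : γ < 2) (hγN : γ < N) (hlam : 0 < lam) (hlam' : lam ≤ N) :
    ∃ C : ℝ≥0, 0 < C ∧ ∀ u : 𝓢(EuclideanSpace ℝ (Fin N), ℝ),
      morreyNorm p lam (fun x => ‖x‖ ^ (-β) * u x) ≤
        C * morreyNorm p lam (fun x => ‖x‖ ^ α * fracLaplacian (γ / 2) u x) := by
  have hN : 0 < N := by
    have : (0 : ℝ) < N := by linarith
    exact_mod_cast this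
  obtain ⟨K, hK⟩ := exists_enorm_le_rieszPotential_fracLaplacian (N := N) (s := γ / 2)
    (by linarith) (by linarith) (by linarith)
  rw [mul_div_cancel₀ γ two_ne_zero] at hK
  obtain ⟨C, hC0, hC⟩ := exists_morreyNorm_le_of_le_rieszPotential hN hp hα hlam hlam' hβ hαβ hγ0 K
  exact ⟨C, hC0, fun u => hC u _ (hK u).1 (hK u).2⟩

theorem theorem5p13 (N : ℕ) :
    -- weighted Rellich inequality
    (∀ p α β lam : ℝ, 1 < p → α + β = 2 → α < N / p.conjExponent → β < (N - lam) / p →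
      0 < lam → lam < min (N : ℝ) (N - β * p) →
      ∃ C : ℝ≥0, 0 < C ∧ ∀ u : EuclideanSpace ℝ (Fin N) → ℝ, ContDiff ℝ 2 u → VanishesInMean u →
        morreyNorm p lam (fun x => u x / ‖x‖ ^ β) ≤
          C * morreyNorm p lam (fun x => ‖x‖ ^ α * Δ u x)) ∧
    -- unweighted Rellich inequality
    (∀ p lam : ℝ, 1 < p → 2 * p < N → 0 < lam → lam < N - 2 * p →
      ∃ C : ℝ≥0, 0 < C ∧ ∀ u : EuclideanSpace ℝ (Fin N) → ℝ, ContDiff ℝ 2 u → VanishesInMean u →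
        morreyNorm p lam (fun x => u x / ‖x‖ ^ 2) ≤ C * morreyNorm p lam (fun x => Δ u x)) ∧
    -- weighted fractional Rellich inequality
    (∀ p α β γ lam : ℝ, 1 < p → α < N / p.conjExponent → β < (N - lam) / p →
      α + β = γ → 1 < γ → γ < 2 → γ * p < N → 0 < lam → lam < min (N : ℝ) (N - γ * p) →
      ∃ C : ℝ≥0, 0 < C ∧ ∀ u : 𝓢(EuclideanSpace ℝ (Fin N), ℝ),
        morreyNorm p lam (fun x => ‖x‖ ^ (-β) * u x) ≤
          C * morreyNorm p lam (fun x => ‖x‖ ^ α * fracLaplacian (γ / 2) u x)) ∧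
    -- unweighted fractional Rellich inequality
    (∀ p γ lam : ℝ, 1 < γ → γ < 2 → 1 < p → γ * p < N → 0 < lam → lam < N - γ * p →
      ∃ C : ℝ≥0, 0 < C ∧ ∀ u : 𝓢(EuclideanSpace ℝ (Fin N), ℝ),
        morreyNorm p lam (fun x => ‖x‖ ^ (-γ) * u x) ≤
          C * morreyNorm p lam (fun x => fracLaplacian (γ / 2) u x)) := by
  refine ⟨fun p α β lam hp hαβ hα hβ h0 h1 => ?_, fun p lam hp hN h0 h1 => ?_,
    fun p α β γ lam hp hα hβ hαβ hγ1 hγ2 hN h0 h1 => ?_, fun p γ lam hγ1 hγ2 hp hN h0 h1 => ?_⟩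
  · exact exists_morreyNorm_rellich_le hp hαβ hα hβ h0 (h1.le.trans (min_le_left _ _))
  · have hp0 : 0 < p := by linarith
    have hN0 : (0 : ℝ) < N := by linarith
    -- For `β = 2` the condition `β < (N - lam)/p` is precisely `lam < N - 2p`.
    obtain ⟨C, hC0, hC⟩ := exists_morreyNorm_rellich_le (N := N) (α := 0) (β := 2) hp (by norm_num)
      (div_pos hN0 (div_pos hp0 (by linarith))) (by rw [lt_div_iff₀ hp0]; linarith) h0
      (by linarith)
    refine ⟨C, hC0, fun u hu hv => ?_⟩
    simpa using hC u hu hv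
  · have hp0 : 0 < p := by linarith
    exact exists_morreyNorm_fractional_rellich_le hp hα hβ hαβ (by linarith) hγ2 (by nlinarith) h0
      (h1.le.trans (min_le_left _ _))
  · have hp0 : 0 < p := by linarith
    have hγN : γ < N := by nlinarith
    obtain ⟨C, hC0, hC⟩ := exists_morreyNorm_fractional_rellich_le (N := N) (α := 0) (β := γ) hp
      (div_pos (by linarith) (div_pos hp0 (by linarith))) (by rw [lt_div_iff₀ hp0]; linarith)
      (zero_add γ) (by linarith) hγ2 hγN h0 (by nlinarith)
    refine ⟨C, hC0, fun u => ?_⟩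
    simpa using hC u
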